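/- Let $\Sigma$ be a finite alphabet. A bi-parameterized problem is a set $P\subseteq\Sigma^*\times\mathbb N\times\mathbb N$ with instances $(x,n,k)$, where $n$ is the fine-grained and $k$ the coarse-grained parameter. All problems are decided by a single deterministic (multi-tape) Turing machine, which receives $x$, $n$ and $k$ as input, and "solvable in time $T(x,n,k)$" means that this machine halts with the correct answer after at most $T(x,n,k)$ steps on every instance. A problem $Q\subseteq\Sigma^*\times\mathbb N\times\Delta^*$ (with $\Delta$ a finite alphabet) with parameter $n$ is in $\mathbf E$ if it is solvable in $2^{an+b}\cdot(|x|+|y|+1)^c$ time on instances $(x,n,y)$, for some constants $a,b,c\in\mathbb N$. A bi-parameterized problem $P$ is in $\mathrm{para}\text{-}\mathbf E$ (in $\mathbf E$ after a precomputation of the parameter $k$) if there are a finite alphabet $\Delta$, a computable function $\pi\colon\mathbb N\to\Delta^*$ and a problem $Q\subseteq\Sigma^*\times\mathbb N\times\Delta^*$ in $\mathbf E$ such that, for all $x,n,k$, $(x,n,k)\in P \Leftrightarrow (x,n,\pi(k))\in Q$. Theorem. For every bi-parameterized problem $P$: 1. $P$ is in $\mathrm{para}\text{-}\mathbf E$ if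 and only if there are a computable function $f\colon\mathbb N\to\mathbb N$ and constants $a,b,c\in\mathbb N$ such that $P$ is solvable in $f(k)\cdot 2^{an+b}\cdot(|x|+1)^c$ time (that is, $P\in\mathbf{FPE}$, the class of problems solvable in $f(k)\cdot 2^{O(n)}\cdot|x|^{O(1)}$ time; so $\mathbf{FPE}=\mathrm{para}\text{-}\mathbf E$). 2. $P$ is in $\mathrm{para}\text{-}\mathbf E$ if and only if there are a computable function $f\colon\mathbb N\to\mathbb N$ and constants $a,b,c\in\mathbb N$ such that $P$ is solvable in $\max(n,2)^{f(k)}\cdot 2^{an+b}\cdot(|x|+1)^c$ time (that is, in $n^{f(k)}\cdot 2^{O(n)}\cdot|x|^{O(1)}$ time, where for $n\le 1$ the base $n$ is replaced by $2$). -/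

import Mathlib

namespace BiParam

open Turing

/-- `DecidedInTime enc P T`: a single Turing machine decides `P` and, on the (encoded) input `a`,
halts after at most `T a` steps. Machines are Mathlib's multi-stack Turing machines with finitely
many stacks, control labels and internal states; the input is on the stack `k₀` (all other stacks
are empty) and the answer is the top symbol of the stack `k₁` in the halting configuration. -/
def DecidedInTime {α Γ : Type} (enc : α → List Γ) (P : Set α) (T : α → ℕ) : Prop :=
  ∃ M : TM2ComputableAux Γ Bool, ∀ a : α, ∃ c : M.tm.Cfg,
    Nonempty (StateTransition.EvalsToInTime M.tm.step
      (initList M.tm ((enc a).map M.inputAlphabet.symm)) (some c) (T a)) ∧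
    c.l = none ∧
    ∃ answer : Bool, (c.stk M.tm.k₁).head?.map M.outputAlphabet = some answer ∧
      (answer = true ↔ a ∈ P)

/-- The input word `x # 1ⁿ # y`; here `inr (inr false)` is the separator `#` and
`inr (inr true)` is the unary digit `1`. -/
def inputWord {A D : Type} (x : List A) (n : ℕ) (y : List D) : List (A ⊕ D ⊕ Bool) :=
  x.map Sum.inl ++ Sum.inr (Sum.inr false) :: List.replicate n (Sum.inr (Sum.inr true)) ++
    Sum.inr (Sum.inr false) :: y.map (fun d => Sum.inr (Sum.inl d))

/-- Encoding of instances `(x, n, y)`, with `n` in unary and `y` a word. -/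
def encodeWord {A D : Type} (i : List A × ℕ × List D) : List (A ⊕ D ⊕ Bool) :=
  inputWord i.1 i.2.1 i.2.2

/-- Encoding of instances `(x, n, k)` of bi-parameterized problems, with `n` and `k` in unary. -/
def encodeBi {A : Type} (i : List A × ℕ × ℕ) : List (A ⊕ Unit ⊕ Bool) :=
  inputWord i.1 i.2.1 (List.replicate i.2.2 ())

/-- The class **E**, for problems `Q ⊆ A* × ℕ × D*` with parameter `n`, where the string part of
an instance `(x, n, y)` is the pair `(x, y)`, of size `|x| + |y|`:
solvable in `2^O(n) * (|x| + |y|)^O(1)` time. -/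
def InE {A D : Type} (Q : Set (List A × ℕ × List D)) : Prop :=
  ∃ a b c : ℕ, DecidedInTime encodeWord Q
    (fun i => 2 ^ (a * i.2.1 + b) * (i.1.length + i.2.2.length + 1) ^ c)

/-- The class **para-E**: bi-parameterized problems `P ⊆ A* × ℕ × ℕ` that are in **E** after a
precomputation of the parameter `k`. Every finite alphabet is, up to renaming, some `Fin m`. -/
def InParaE {A : Type} (P : Set (List A × ℕ × ℕ)) : Prop :=
  ∃ (m : ℕ) (π : ℕ → List (Fin m)) (Q : Set (List A × ℕ × List (Fin m))),
    Computable π ∧ InE Q ∧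
      ∀ (x : List A) (n k : ℕ), (x, n, k) ∈ P ↔ (x, n, π k) ∈ Q

/-- The class **FPE**: solvable in `f(k) * 2^O(n) * |x|^O(1)` time, for a computable `f`. -/
def InFPE {A : Type} (P : Set (List A × ℕ × ℕ)) : Prop :=
  ∃ f : ℕ → ℕ, Computable f ∧ ∃ a b c : ℕ, DecidedInTime encodeBi P
    (fun i => f i.2.2 * 2 ^ (a * i.2.1 + b) * (i.1.length + 1) ^ c)

/-- Solvable in `n^f(k) * 2^O(n) * |x|^O(1)` time, for a computable `f`. The base is `max n 2`
because for `n ≤ 1` the power `n^f(k)` could not grow with `k` at all. -/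
def InPowTime {A : Type} (P : Set (List A × ℕ × ℕ)) : Prop :=
  ∃ f : ℕ → ℕ, Computable f ∧ ∃ a b c : ℕ, DecidedInTime encodeBi P
    (fun i => max i.2.1 2 ^ f i.2.2 * 2 ^ (a * i.2.1 + b) * (i.1.length + 1) ^ c)

end BiParam

/-!
The two time bounds define the same class because `n ^ p ≤ p! * 2 ^ (n + p + 1)`
(`max_pow_le`) and `f ≤ 2 ^ f`. The rest is the equality of **para-E** and **FPE**, which is shown
by building machines.

From **para-E** to **FPE** (`InParaE.inFPE`), the machine computes `π k` from `k` and then runs the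
machine for the problem in **E** on `(x, n, π k)`. The bound on its time has to be a computable
function of `k`, and it is: since a step of a Turing machine is primitive recursive, the running
time of a machine that always halts is computable (`computable_time`).

From **FPE** to **para-E** (`InFPE.inParaE`), the machine for **FPE** may only be run on `(x, n, k)`
if `f k` is bounded by the length of the precomputed word, for arbitrary words in place of `π k`.
Instead of a clock for the whole computation, the words carry a certificate for this bound: a word
consists of the number `k` in unary and of a number of ticks, and it is accepted only if a fixed
machine, whose running time `T k` is at least `f k`, halts on `k` within that number of steps.
Then `f k ≤ T k` is at most the length of the word, and the machine for **FPE** can be run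
without a clock. The precomputed word for `k` has `T k` ticks; it is computable because `T` is.
The inequality `f k ≤ T k` is obtained by letting the fixed machine write a word of a length
proportional to `f k + k` (`length_stk_le_of_stepsTo`).

Both directions use the same construction, `FrontEnd`: a machine is preceded by a program that
reads the input and sorts its symbols, runs a machine for a computable function on the parameter,
possibly against a clock, and decodes the result into symbols of the input of the machine that
follows. The machines for computable functions come from Mathlib's compiler of partial recursive
functions to machines with four stacks (`exists_finite_machine`).
-/

namespace BiParam

open Turing Function PartrecToTM2 ToPartrec

/-! ### Counting steps of a transition system -/

/-- `StepsTo f n a b`: the transition function `f` leads from `a` to `b` in exactly `n` steps. -/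
def StepsTo {S : Type*} (f : S → Option S) (n : ℕ) (a b : S) : Prop :=
  (flip bind f)^[n] (some a) = some b

namespace StepsTo

variable {S : Type*} {f : S → Option S} {m n : ℕ} {a b c : S}

theorem refl (a : S) : StepsTo f 0 a a := rfl

theorem head (h : f a = some b) (h' : StepsTo f n b c) : StepsTo f (n + 1) a c := by
  have : flip bind f (some a) = some b := h
  rw [StepsTo, iterate_succ_apply, this]
  exact h'

theorem single (h : f a = some b) : StepsTo f 1 a b := head h (refl b)

theorem trans (h : StepsTo f m a b) (h' : StepsTo f n b c) : StepsTo f (m + n) a c := by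
  rw [StepsTo, Nat.add_comm, iterate_add_apply]
  rw [StepsTo] at h h'
  rw [h, h']

theorem succ_iff : StepsTo f (n + 1) a c ↔ ∃ b, f a = some b ∧ StepsTo f n b c := by
  refine ⟨fun h => ?_, fun ⟨b, h, h'⟩ => head h h'⟩
  rw [StepsTo, iterate_succ_apply] at h
  have hf : flip bind f (some a) = f a := rfl
  rw [hf] at h
  cases hb : f a with
  | none =>
    rw [hb] at h
    have h₀ : (flip bind f)^[n] (none : Option S) = none := iterate_fixed rfl n
    exact absurd (h₀.symm.trans h) (by simp)
  | some b => exact ⟨b, rfl, by rwa [hb] at h⟩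

/-- A shorter run is a prefix of a longer one. -/
theorem exists_of_le (h : StepsTo f n a c) (hm : m ≤ n) : ∃ b, StepsTo f m a b := by
  induction m generalizing n a with
  | zero => exact ⟨a, refl a⟩
  | succ m ih =>
    obtain ⟨n, rfl⟩ : ∃ n', n = n' + 1 := ⟨n - 1, by omega⟩
    obtain ⟨b, hb, h'⟩ := succ_iff.1 h
    obtain ⟨d, hd⟩ := ih h' (by omega)
    exact ⟨d, head hb hd⟩

theorem unique (h : StepsTo f n a b) (h' : StepsTo f n a c) : b = c := by
  rw [StepsTo] at h h'
  exact Option.some.inj (h.symm.trans h')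

/-- A run can only be continued from a configuration that has a successor. -/
theorem exists_next (h : StepsTo f n a c) (h' : StepsTo f m a b) (hm : m < n) :
    ∃ d, f b = some d := by
  induction m generalizing n a with
  | zero =>
    obtain rfl : a = b := unique (refl a) h'
    obtain ⟨n, rfl⟩ : ∃ n', n = n' + 1 := ⟨n - 1, by omega⟩
    obtain ⟨d, hd, -⟩ := succ_iff.1 h
    exact ⟨d, hd⟩
  | succ m ih =>
    obtain ⟨n, rfl⟩ : ∃ n', n = n' + 1 := ⟨n - 1, by omega⟩
    obtain ⟨d, hd, h⟩ := succ_iff.1 h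
    obtain ⟨d', hd', h'⟩ := succ_iff.1 h'
    obtain rfl : d = d' := Option.some.inj (hd.symm.trans hd')
    exact ih h h' (by omega)

theorem exists_of_reaches (h : StateTransition.Reaches f a b) : ∃ n, StepsTo f n a b := by
  induction h with
  | refl => exact ⟨0, refl a⟩
  | tail _ hbc ih =>
    obtain ⟨n, hn⟩ := ih
    exact ⟨n + 1, hn.trans (single hbc)⟩

theorem evalsToInTime (h : StepsTo f n a b) (hm : n ≤ m) :
    Nonempty (StateTransition.EvalsToInTime f a (some b) m) :=
  ⟨⟨⟨n, h⟩, hm⟩⟩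

end StepsTo

/-! ### Embedding a stack machine into a larger one -/

section Lift

variable {K₁ K₂ : Type*} {Λ₁ Λ₂ σ₁ σ₂ : Type*} (Γ : K₂ → Type*) (κ : K₁ → K₂)
  (get : σ₂ → σ₁) (set : σ₁ → σ₂ → σ₂) (lab : Λ₁ → Λ₂) (ex : Option Λ₂)

/-- Translate a statement of a machine with stacks `K₁`, labels `Λ₁` and memory `σ₁` to a machine
whose stacks, labels and memory contain those of the first (via `κ`, `lab` and the lens
`get`, `set`). Where the first machine halts, the translation goes to the label `ex`, or halts if
`ex = none`. -/
def liftStmt : TM2.Stmt (fun k => Γ (κ k)) Λ₁ σ₁ → TM2.Stmt Γ Λ₂ σ₂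
  | .push k f q => .push (κ k) (fun v => f (get v)) (liftStmt q)
  | .peek k f q => .peek (κ k) (fun v s => set (f (get v) s) v) (liftStmt q)
  | .pop k f q => .pop (κ k) (fun v s => set (f (get v) s) v) (liftStmt q)
  | .load f q => .load (fun v => set (f (get v)) v) (liftStmt q)
  | .branch f q₁ q₂ => .branch (fun v => f (get v)) (liftStmt q₁) (liftStmt q₂)
  | .goto f => .goto fun v => lab (f (get v))
  | .halt => ex.elim .halt fun l => .goto fun _ => l

variable {Γ κ get set}

/-- The configuration of the larger machine that corresponds to a configuration of the smaller
one: `emb` places the stacks, and `v` is the memory outside the lens. -/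
def liftCfg (set : σ₁ → σ₂ → σ₂) (emb : (∀ k, List (Γ (κ k))) → ∀ k, List (Γ k)) (v : σ₂)
    (c : TM2.Cfg (fun k => Γ (κ k)) Λ₁ σ₁) : TM2.Cfg Γ Λ₂ σ₂ :=
  ⟨c.l.elim ex fun l => some (lab l), set c.var v, emb c.stk⟩

variable [DecidableEq K₁] [DecidableEq K₂]

/-- The larger machine simulates the smaller one step by step. The hypotheses are the laws of the
lens `get`, `set`, and of the embedding `emb` of the stacks. -/
theorem stepAux_liftStmt (hget : ∀ s v, get (set s v) = s)
    (hset : ∀ s s' v, set s (set s' v) = set s v)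
    {emb : (∀ k, List (Γ (κ k))) → ∀ k, List (Γ k)} (hemb : ∀ S k, emb S (κ k) = S k)
    (hupd : ∀ S k a, update (emb S) (κ k) a = emb (update S k a)) (v : σ₂)
    (q : TM2.Stmt (fun k => Γ (κ k)) Λ₁ σ₁) (s : σ₁) (S : ∀ k, List (Γ (κ k))) :
    TM2.stepAux (liftStmt Γ κ get set lab ex q) (set s v) (emb S) =
      liftCfg lab ex set emb v (TM2.stepAux q s S) := by
  induction q generalizing s S with
  | push k f q ih => simp only [liftStmt, TM2.stepAux, hget, hemb, hupd, ih]
  | peek k f q ih => simp only [liftStmt, TM2.stepAux, hget, hemb, hset, ih]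
  | pop k f q ih => simp only [liftStmt, TM2.stepAux, hget, hemb, hset, hupd, ih]
  | load f q ih => simp only [liftStmt, TM2.stepAux, hget, hset, ih]
  | branch f q₁ q₂ ih₁ ih₂ =>
    simp only [liftStmt, TM2.stepAux, hget]
    cases f s <;> simp [ih₁, ih₂]
  | goto f => simp [liftStmt, TM2.stepAux, hget, liftCfg]
  | halt => cases ex <;> simp [liftStmt, TM2.stepAux, liftCfg]

end Lift

/-! ### Growth of stacks -/

/-- The largest number of symbols that a statement pushes, on all stacks together. -/
def pushCount {K Λ σ : Type*} {Γ : K → Type*} : TM2.Stmt Γ Λ σ → ℕ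
  | .push _ _ q => pushCount q + 1
  | .peek _ _ q | .pop _ _ q | .load _ q => pushCount q
  | .branch _ q₁ q₂ => max (pushCount q₁) (pushCount q₂)
  | .goto _ | .halt => 0

theorem length_stepAux_le {K Λ σ : Type*} {Γ : K → Type*} [DecidableEq K] (q : TM2.Stmt Γ Λ σ)
    (v : σ) (S : ∀ k, List (Γ k)) (k : K) :
    ((TM2.stepAux q v S).stk k).length ≤ (S k).length + pushCount q := by
  induction q generalizing v S with
  | push k' f q ih =>
    refine (ih _ _).trans ?_
    by_cases h : k = k'
    · subst h; simp [pushCount]; omega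
    · simp [pushCount, h]
  | peek k' f q ih => exact ih _ _
  | pop k' f q ih =>
    refine (ih _ _).trans ?_
    by_cases h : k = k'
    · subst h; simp [pushCount]
    · simp [pushCount, h]
  | load f q ih => exact ih _ _
  | branch f q₁ q₂ ih₁ ih₂ =>
    have h₁ := ih₁ v S
    have h₂ := ih₂ v S
    simp only [TM2.stepAux, pushCount]
    cases f v <;> simp <;> omega
  | goto f => simp [TM2.stepAux]
  | halt => simp [TM2.stepAux]

theorem pushCount_liftStmt {K₁ K₂ Λ₁ Λ₂ σ₁ σ₂ : Type*} {Γ : K₂ → Type*} {κ : K₁ → K₂}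
    {get : σ₂ → σ₁} {set : σ₁ → σ₂ → σ₂} {lab : Λ₁ → Λ₂} {ex : Option Λ₂}
    (q : TM2.Stmt (fun k => Γ (κ k)) Λ₁ σ₁) :
    pushCount (liftStmt Γ κ get set lab ex q) = pushCount q := by
  induction q with
  | push k f q ih => simp [liftStmt, pushCount, ih]
  | peek k f q ih => simp [liftStmt, pushCount, ih]
  | pop k f q ih => simp [liftStmt, pushCount, ih]
  | load f q ih => simp [liftStmt, pushCount, ih]
  | branch f q₁ q₂ ih₁ ih₂ => simp [liftStmt, pushCount, ih₁, ih₂]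
  | goto f => simp [liftStmt, pushCount]
  | halt => cases ex <;> simp [liftStmt, pushCount]

theorem length_stk_le_of_stepsTo {K Λ σ : Type*} {Γ : K → Type*} [DecidableEq K]
    {M : Λ → TM2.Stmt Γ Λ σ} {p : ℕ} (hM : ∀ l, pushCount (M l) ≤ p) (k : K) {n : ℕ}
    {c c' : TM2.Cfg Γ Λ σ} (h : StepsTo (TM2.step M) n c c') :
    (c'.stk k).length ≤ (c.stk k).length + p * n := by
  induction n generalizing c with
  | zero => rw [StepsTo.unique h (StepsTo.refl c)]; omega
  | succ n ih =>
    obtain ⟨d, hd, h⟩ := StepsTo.succ_iff.1 h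
    have h₁ := ih h
    obtain ⟨_ | l, v, S⟩ := c
    · simp at hd
    · simp only [TM2.step, Option.some.injEq] at hd
      have h₂ := length_stepAux_le (M l) v S k
      rw [hd] at h₂
      have h₃ := hM l
      simp only at h₂ ⊢
      rw [Nat.mul_succ]
      omega

/-! ### Machines for computable functions on unary numbers -/

instance : Fintype K' := ⟨{K'.main, K'.rev, K'.aux, K'.stack}, fun k => by cases k <;> simp⟩

/-- Least significant digit first; `n = 0` is excluded because `0` has no digits. -/
theorem trNat_two_mul {n : ℕ} (hn : 0 < n) : trNat (2 * n) = Γ'.bit0 :: trNat n := by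
  have h : ((2 * n : ℕ) : Num) = Num.bit0 (n : Num) := by
    rw [← Num.bit0_of_bit0]; push_cast; ring
  rw [trNat, h, trNat]
  cases h' : (n : Num) with
  | zero =>
    have : ((n : Num) : ℕ) = 0 := by rw [h']; rfl
    simp at this; omega
  | pos p => rfl

theorem trNat_two_mul_add_one (n : ℕ) : trNat (2 * n + 1) = Γ'.bit1 :: trNat n := by
  have h : ((2 * n + 1 : ℕ) : Num) = Num.bit1 (n : Num) := by
    rw [← Num.bit1_of_bit1]; push_cast; ring
  rw [trNat, h, trNat]
  cases (n : Num) <;> rfl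

theorem trNat_two_pow_sub_one (L : ℕ) : trNat (2 ^ L - 1) = List.replicate L Γ'.bit1 := by
  induction L with
  | zero => simp
  | succ L ih =>
    have : 2 ^ (L + 1) - 1 = 2 * (2 ^ L - 1) + 1 := by
      have := Nat.one_le_two_pow (n := L); rw [pow_succ]; omega
    rw [this, trNat_two_mul_add_one, ih, List.replicate_succ]

/-- The list `[1, ..., 1]` of `k` ones as a stack content of Mathlib's machines for partial
recursive functions: this is how these machines get a number `k` in unary. -/
def unaryStack (k : ℕ) : List Γ' := trList (List.replicate k 1)

theorem unaryStack_succ (k : ℕ) :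
    unaryStack (k + 1) = Γ'.bit1 :: Γ'.cons :: unaryStack k := by
  have := trNat_two_mul_add_one 0
  simp at this
  simp [unaryStack, List.replicate_succ, this]

theorem length_unaryStack (k : ℕ) : (unaryStack k).length = 2 * k := by
  induction k with
  | zero => rfl
  | succ k ih => simp [unaryStack_succ, ih]; omega

/-- One round of a loop on `acc :: v`: move a nonzero head of `v` over to the counter `acc`. -/
def lengthBody : Code :=
  .comp (.case (.cons .zero .id) (.cons (.comp .succ .zero)
    (.cons (.comp .succ .tail) (.comp .tail .tail))))
    (.cons (.comp .head .tail) (.cons .head (.comp .tail .tail)))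

theorem eval_comp_eq {f g : Code} {v w u : List ℕ} (hg : g.eval v = pure w)
    (hf : f.eval w = pure u) : (Code.comp f g).eval v = pure u := by
  rw [Code.comp_eval]
  change g.eval v >>= f.eval = _
  rw [hg]
  exact (Part.bind_some w f.eval).trans hf

theorem eval_cons_eq {f g : Code} {v w u : List ℕ} (hf : f.eval v = pure w)
    (hg : g.eval v = pure u) : (Code.cons f g).eval v = pure (w.headI :: u) := by
  rw [Code.cons_eval]
  change (f.eval v >>= fun n => g.eval v >>= fun ns => pure (n.headI :: ns)) = _
  rw [hf, pure_bind, hg, pure_bind]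

theorem eval_tail_eq (v : List ℕ) : Code.tail.eval v = pure v.tail := by simp

theorem eval_succ_eq (v : List ℕ) : Code.succ.eval v = pure [v.headI.succ] := by simp

theorem eval_lengthBody_permute (v : List ℕ) :
    (Code.cons (.comp .head .tail) (.cons .head (.comp .tail .tail))).eval v =
      pure (v.tail.headI :: v.headI :: v.tail.tail) :=
  eval_cons_eq (w := [v.tail.headI]) (eval_comp_eq (eval_tail_eq v) (Code.head_eval v.tail))
    (eval_cons_eq (w := [v.headI]) (Code.head_eval v)
      (eval_comp_eq (eval_tail_eq _) (eval_tail_eq _)))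

theorem lengthBody_nil (n : ℕ) : lengthBody.eval [n] = pure [0, n] := by
  refine eval_comp_eq (eval_lengthBody_permute _) ?_
  rw [Code.case_eval]
  exact eval_cons_eq (Code.zero_eval _) (Code.id_eval _)

theorem lengthBody_one (n : ℕ) (v : List ℕ) :
    lengthBody.eval (n :: 1 :: v) = pure (1 :: (n + 1) :: v) := by
  refine eval_comp_eq (eval_lengthBody_permute _) ?_
  rw [Code.case_eval]
  exact eval_cons_eq (eval_comp_eq (Code.zero_eval _) (eval_succ_eq _))
    (eval_cons_eq (eval_comp_eq (eval_tail_eq _) (eval_succ_eq _))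
      (eval_comp_eq (eval_tail_eq _) (eval_tail_eq _)))

/-- The loop computes the length of a list of ones. -/
theorem fix_lengthBody (n k : ℕ) :
    [n + k] ∈ (Code.fix lengthBody).eval (n :: List.replicate k 1) := by
  rw [Code.fix_eval]
  induction k generalizing n with
  | zero =>
    refine PFun.mem_fix_iff.2 (Or.inl ?_)
    simp [lengthBody_nil]
  | succ k ih =>
    refine PFun.mem_fix_iff.2 (Or.inr ⟨(n + 1) :: List.replicate k 1, ?_, ?_⟩)
    · rw [List.replicate_succ, lengthBody_one]; simp
    · have := ih (n + 1)
      rwa [show n + 1 + k = n + (k + 1) by omega] at this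

/-- Every computable function `ℕ → ℕ` has a code that takes its argument in unary. -/
theorem exists_code_unary {g : ℕ → ℕ} (hg : Computable g) :
    ∃ c : Code, ∀ k, c.eval (List.replicate k 1) = pure [g k] := by
  have h : Nat.Partrec' (n := 1) fun v => (g v.head : Part ℕ) :=
    Nat.Partrec'.part_iff₁.2 hg
  obtain ⟨c, hc⟩ := Code.exists_code h
  refine ⟨.comp c (.comp (.fix lengthBody) .zero'), fun k => ?_⟩
  have h₁ : (Code.fix lengthBody).eval (0 :: List.replicate k 1) = pure [k] := by
    have := fix_lengthBody 0 k
    rw [Nat.zero_add] at this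
    exact Part.eq_some_iff.2 this
  have h₀ : Code.zero'.eval (List.replicate k 1) = pure (0 :: List.replicate k 1) := by simp
  refine eval_comp_eq (eval_comp_eq h₀ h₁) ((hc ⟨[k], rfl⟩).trans ?_)
  simp [List.Vector.head]

/-! ### Computability of running times -/

section Running

variable {Λ : Type} [Primcodable Λ]

/-- Configurations of a machine on the stacks `K'` as tuples, a type with an encoding. -/
abbrev CodeCfg (Λ : Type) : Type :=
  Option Λ × Option Γ' × List Γ' × List Γ' × List Γ' × List Γ'

noncomputable instance : Primcodable Γ' :=
  Primcodable.ofEquiv (Fin (Fintype.card Γ')) (Fintype.equivFin Γ')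

/-- The configuration represented by a tuple. -/
def CodeCfg.toCfg (c : CodeCfg Λ) : TM2.Cfg (fun _ : K' => Γ') Λ (Option Γ') :=
  ⟨c.1, c.2.1, K'.elim c.2.2.1 c.2.2.2.1 c.2.2.2.2.1 c.2.2.2.2.2⟩

/-- A function of two variables, the first from a finite type, is primitive recursive as soon as
it is so for each value of the first variable. -/
theorem primrec₂_of_finite [Fintype Λ] {α β : Type} [Primcodable α] [Primcodable β] {g : Λ → α → β}
    (hg : ∀ l, Primrec (g l)) : Primrec₂ g := by
  classical
  -- Tabulate the first variable.
  have key : ∀ L : List Λ, ∃ h : Λ → α → Option β, Primrec₂ h ∧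
      ∀ l ∈ L, ∀ a, h l a = some (g l a) := by
    intro L
    induction L with
    | nil => exact ⟨fun _ _ => none, Primrec.const none, by simp⟩
    | cons l₀ L ih =>
      obtain ⟨h, hh, hL⟩ := ih
      refine ⟨fun l a => if l = l₀ then some (g l₀ a) else h l a, ?_, ?_⟩
      · exact Primrec.ite (Primrec.eq.comp Primrec.fst (Primrec.const l₀))
          (Primrec.option_some.comp ((hg l₀).comp Primrec.snd)) hh
      · intro l hl a
        by_cases hll : l = l₀
        · simp [hll]
        · simp only [hll, if_false]
          exact hL l (by simpa [hll] using hl) a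
  obtain ⟨h, hh, hL⟩ := key Finset.univ.toList
  refine Primrec.option_some_iff.1 (Primrec.of_eq hh fun p => ?_)
  exact hL p.1 (by simp) p.2

/-- Replace the stack `k` in a quadruple of stacks. -/
def CodeCfg.update (k : K') (a : List Γ') (S : List Γ' × List Γ' × List Γ' × List Γ') :
    List Γ' × List Γ' × List Γ' × List Γ' :=
  match k with
  | K'.main => (a, S.2)
  | K'.rev => (S.1, a, S.2.2)
  | K'.aux => (S.1, S.2.1, a, S.2.2.2)
  | K'.stack => (S.1, S.2.1, S.2.2.1, a)

/-- A quadruple of stacks as a family indexed by `K'`. -/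
abbrev CodeCfg.elim (S : List Γ' × List Γ' × List Γ' × List Γ') : K' → List Γ' :=
  K'.elim S.1 S.2.1 S.2.2.1 S.2.2.2

theorem CodeCfg.elim_update (k : K') (a : List Γ') (S) :
    CodeCfg.elim (CodeCfg.update k a S) = Function.update (CodeCfg.elim S) k a := by
  cases k <;> simp [CodeCfg.update, CodeCfg.elim]

theorem CodeCfg.primrec_elim (k : K') : Primrec fun S => CodeCfg.elim S k := by
  cases k
  · exact Primrec.fst
  · exact Primrec.fst.comp Primrec.snd
  · exact Primrec.fst.comp (Primrec.snd.comp Primrec.snd)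
  · exact Primrec.snd.comp (Primrec.snd.comp Primrec.snd)

theorem CodeCfg.primrec_update (k : K') : Primrec₂ (CodeCfg.update k) := by
  have h₁ := (Primrec.fst (α := List Γ') (β := List Γ' × List Γ' × List Γ' × List Γ'))
  have h₂ := (Primrec.snd (α := List Γ') (β := List Γ' × List Γ' × List Γ' × List Γ'))
  have e₁ := Primrec.fst.comp h₂
  have t₁ := Primrec.snd.comp h₂
  have e₂ := Primrec.fst.comp t₁
  have t₂ := Primrec.snd.comp t₁
  have e₃ := Primrec.fst.comp t₂
  have e₄ := Primrec.snd.comp t₂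
  cases k
  · exact h₁.pair t₁
  · exact e₁.pair (h₁.pair t₂)
  · exact e₁.pair (e₂.pair (h₁.pair e₄))
  · exact e₁.pair (e₂.pair (e₃.pair h₁))

/-- A single statement has a primitive recursive effect, since the functions of the finite memory
that occur in it are primitive recursive. -/
theorem exists_primrec_stepAux (q : TM2.Stmt (fun _ : K' => Γ') Λ (Option Γ')) :
    ∃ F : Option Γ' × List Γ' × List Γ' × List Γ' × List Γ' → CodeCfg Λ, Primrec F ∧
      ∀ v S, (F (v, S)).toCfg = TM2.stepAux q v (CodeCfg.elim S) := by
  have hhead := fun k => Primrec.list_head?.comp ((CodeCfg.primrec_elim k).comp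
    (Primrec.snd (α := Option Γ')))
  induction q with
  | push k f q ih =>
    obtain ⟨F, hF, h⟩ := ih
    refine ⟨fun p => F (p.1, CodeCfg.update k (f p.1 :: CodeCfg.elim p.2 k) p.2), ?_, ?_⟩
    · exact hF.comp (Primrec.fst.pair ((CodeCfg.primrec_update k).comp
        (Primrec.list_cons.comp ((Primrec.dom_finite f).comp Primrec.fst)
          ((CodeCfg.primrec_elim k).comp Primrec.snd)) Primrec.snd))
    · intro v S
      rw [h, CodeCfg.elim_update]; rfl
  | peek k f q ih =>
    obtain ⟨F, hF, h⟩ := ih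
    refine ⟨fun p => F (f p.1 (CodeCfg.elim p.2 k).head?, p.2), ?_, fun v S => h _ _⟩
    exact hF.comp (((Primrec.dom_finite fun x : Option Γ' × Option Γ' => f x.1 x.2).comp
      (Primrec.fst.pair (hhead k))).pair Primrec.snd)
  | pop k f q ih =>
    obtain ⟨F, hF, h⟩ := ih
    refine ⟨fun p => F (f p.1 (CodeCfg.elim p.2 k).head?,
      CodeCfg.update k (CodeCfg.elim p.2 k).tail p.2), ?_, ?_⟩
    · exact hF.comp (((Primrec.dom_finite fun x : Option Γ' × Option Γ' => f x.1 x.2).comp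
        (Primrec.fst.pair (hhead k))).pair ((CodeCfg.primrec_update k).comp
          (Primrec.list_tail.comp ((CodeCfg.primrec_elim k).comp Primrec.snd)) Primrec.snd))
    · intro v S
      rw [h, CodeCfg.elim_update]; rfl
  | load f q ih =>
    obtain ⟨F, hF, h⟩ := ih
    exact ⟨fun p => F (f p.1, p.2),
      hF.comp (((Primrec.dom_finite f).comp Primrec.fst).pair Primrec.snd), fun v S => h _ _⟩
  | branch f q₁ q₂ ih₁ ih₂ =>
    obtain ⟨F₁, hF₁, h₁⟩ := ih₁
    obtain ⟨F₂, hF₂, h₂⟩ := ih₂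
    refine ⟨fun p => cond (f p.1) (F₁ p) (F₂ p),
      Primrec.cond ((Primrec.dom_finite f).comp Primrec.fst) hF₁ hF₂, fun v S => ?_⟩
    simp only [TM2.stepAux]
    cases f v <;> simp [h₁, h₂]
  | goto f =>
    exact ⟨fun p => (some (f p.1), p), (Primrec.option_some.comp
      ((Primrec.dom_finite f).comp Primrec.fst)).pair Primrec.id, fun v S => rfl⟩
  | halt => exact ⟨fun p => (none, p), (Primrec.const none).pair Primrec.id, fun v S => rfl⟩

/-- The step function of a machine is primitive recursive; halting configurations are mapped to
themselves here. -/
theorem exists_primrec_step [Fintype Λ] (M : Λ → TM2.Stmt (fun _ : K' => Γ') Λ (Option Γ')) :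
    ∃ F : CodeCfg Λ → CodeCfg Λ, Primrec F ∧
      ∀ c, (F c).toCfg = (TM2.step M c.toCfg).getD c.toCfg := by
  choose G hG h using fun l => exists_primrec_stepAux (M l)
  refine ⟨fun c => Option.casesOn c.1 c fun l => G l c.2,
    Primrec.option_casesOn (f := fun c => c) (g := fun c l => G l c.2) Primrec.fst Primrec.id
      ((primrec₂_of_finite hG).comp Primrec.snd (Primrec.snd.comp Primrec.fst)).to₂, ?_⟩
  rintro ⟨_ | l, v, S⟩
  · rfl
  · exact h l v S

/-- The running time of a machine that halts on all inputs is computable. -/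
theorem computable_time [Fintype Λ] (M : Λ → TM2.Stmt (fun _ : K' => Γ') Λ (Option Γ'))
    {init : ℕ → CodeCfg Λ} (hinit : Primrec init) {T : ℕ → ℕ}
    (hT : ∀ k, ∃ c, StepsTo (TM2.step M) (T k) (init k).toCfg c ∧ c.l = none) : Computable T := by
  obtain ⟨F, hF, hFM⟩ := exists_primrec_step M
  -- Iterates of `F` agree with runs of `M`.
  have hrun : ∀ (n : ℕ) (c d : CodeCfg Λ) (e), StepsTo (TM2.step M) n c.toCfg e → F^[n] c = d →
      d.toCfg = e := by
    intro n
    induction n with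
    | zero => rintro c d e h rfl; exact (StepsTo.unique h (StepsTo.refl _)).symm
    | succ n ih =>
      intro c d e h hd
      obtain ⟨b, hb, h⟩ := StepsTo.succ_iff.1 h
      have hc := hFM c
      rw [hb, Option.getD_some] at hc
      exact ih (F c) d e (hc ▸ h) hd
  have hiter : Primrec₂ fun k n : ℕ => F^[n] (init k) :=
    Primrec.nat_iterate Primrec.snd (hinit.comp Primrec.fst) (hF.comp₂ Primrec₂.right)
  have hp : Primrec₂ fun k n : ℕ => (F^[n] (init k)).1.isNone :=
    (Primrec.dom_finite (fun l : Option Λ => l.isNone)).comp₂ (Primrec.fst.comp₂ hiter)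
  -- The running time is the least `n` for which the configuration after `n` steps is halting.
  have hfind := Partrec.rfind (p := fun k n => Part.some (F^[n] (init k)).1.isNone)
    hp.to_comp.partrec₂
  refine hfind.of_eq fun k => Part.eq_some_iff.2 (Nat.mem_rfind.2 ⟨?_, fun {n} hn => ?_⟩)
  · obtain ⟨c, hc, hl⟩ := hT k
    have := hrun _ _ _ _ hc rfl
    have h' : (F^[T k] (init k)).1 = none := by rw [← hl, ← this]; rfl
    simp [h']
  · obtain ⟨c, hc, hl⟩ := hT k
    obtain ⟨b, hb⟩ := hc.exists_of_le hn.le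
    obtain ⟨d, hd⟩ := hc.exists_next hb hn
    have hbl : b.l ≠ none := by
      rintro h
      obtain ⟨_ | l, v, S⟩ := b
      · simp at hd
      · simp at h
    have := hrun _ _ _ _ hb rfl
    rw [← this] at hbl
    simp only [Part.mem_some_iff]
    change (F^[n] (init k)).1 ≠ none at hbl
    cases h : (F^[n] (init k)).1 with
    | none => exact absurd h hbl
    | some _ => rfl

end Running

theorem primrec_unaryStack : Primrec unaryStack := by
  have h : Primrec fun k : ℕ => Nat.rec (motive := fun _ => List Γ') []
      (fun _ s => Γ'.bit1 :: Γ'.cons :: s) k :=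
    Primrec.nat_rec' Primrec.id (Primrec.const _) (Primrec.list_cons.comp (Primrec.const _)
      (Primrec.list_cons.comp (Primrec.const _) (Primrec.snd.comp Primrec.snd))).to₂
  refine h.of_eq fun k => ?_
  induction k with
  | zero => rfl
  | succ k ih => rw [unaryStack_succ, ← ih]

/-- Mathlib's machines for partial recursive functions push at most two symbols in a step. -/
theorem pushCount_tr_le (q : Λ') : pushCount (tr q) ≤ 2 := by
  cases q with
  | ret k => cases k <;> simp [pushCount]
  | _ => simp [pushCount]

/-- Every computable `g : ℕ → ℕ` is computed by a finite machine on the stacks `K'` which gets its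
argument in unary and returns the value in binary. Its running time is computable, and each of
its steps makes a stack longer by at most two symbols. -/
theorem exists_finite_machine {g : ℕ → ℕ} (hg : Computable g) :
    ∃ (Λ : Type) (_ : Fintype Λ) (main : Λ)
      (M : Λ → TM2.Stmt (fun _ : K' => Γ') Λ (Option Γ')) (T : ℕ → ℕ),
      (∀ l, pushCount (M l) ≤ 2) ∧ Computable T ∧
      ∀ k, StepsTo (TM2.step M) (T k) ⟨some main, none, K'.elim (unaryStack k) [] [] []⟩
        ⟨none, none, K'.elim (trList [g k]) [] [] []⟩ := by
  classical
  obtain ⟨c, hc⟩ := exists_code_unary hg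
  set s := codeSupp c Cont'.halt
  obtain ⟨hmem, hsupp⟩ := tr_supports c Cont'.halt
  let main : s := ⟨trNormal c Cont'.halt, hmem⟩
  -- The value of `lab` outside `s` does not matter.
  let lab : Λ' → s := fun q => if h : q ∈ s then ⟨q, h⟩ else main
  -- Mathlib's machine has infinitely many labels, of which only those in `s` are reachable.
  let M : s → TM2.Stmt (fun _ : K' => Γ') s (Option Γ') := fun q =>
    liftStmt (κ := id) (fun _ => Γ') (fun v => v) (fun v _ => v) lab none (tr q)
  let lift : TM2.Cfg (fun _ : K' => Γ') Λ' (Option Γ') → TM2.Cfg (fun _ : K' => Γ') s (Option Γ') :=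
    liftCfg (Γ := fun _ => Γ') (κ := id) lab none (fun v _ => v) id none
  have hstep : ∀ a b, a.l ∈ Finset.insertNone s → TM2.step tr a = some b →
      TM2.step M (lift a) = some (lift b) := by
    rintro ⟨_ | q, v, S⟩ b ha hb
    · cases show none = some b from hb
    · have hq : q ∈ s := Finset.some_mem_insertNone.1 ha
      obtain rfl : TM2.stepAux (tr q) v S = b := Option.some.inj hb
      have hlab : lab q = ⟨q, hq⟩ := dif_pos hq
      simp only [lift, liftCfg, Option.elim, TM2.step, hlab, M, Option.some.injEq]
      exact stepAux_liftStmt (Γ := fun _ => Γ') (κ := id) lab none (get := fun v => v)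
        (set := fun v _ => v) (fun _ _ => rfl) (fun _ _ _ => rfl) (emb := id)
        (fun _ _ => rfl) (fun _ _ _ => rfl) none (tr q) v S
  have hsteps : ∀ n a b, a.l ∈ Finset.insertNone s → StepsTo (TM2.step tr) n a b →
      StepsTo (TM2.step M) n (lift a) (lift b) := by
    intro n
    induction n with
    | zero =>
      intro a b _ h
      rw [StepsTo.unique h (StepsTo.refl a)]
      exact StepsTo.refl _
    | succ n ih =>
      intro a b ha h
      obtain ⟨d, hd, h⟩ := StepsTo.succ_iff.1 h
      let : Inhabited Λ' := ⟨trNormal c Cont'.halt⟩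
      exact StepsTo.head (hstep a d ha hd)
        (ih d b (TM2.step_supports tr ⟨hmem, hsupp⟩ hd ha) h)
  have hrun : ∀ k, ∃ n, StepsTo (TM2.step M) n
      ⟨some main, none, K'.elim (unaryStack k) [] [] []⟩
      ⟨none, none, K'.elim (trList [g k]) [] [] []⟩ := by
    intro k
    have h := tr_eval c (List.replicate k 1)
    rw [hc k] at h
    have h' : PartrecToTM2.halt [g k] ∈
        StateTransition.eval (TM2.step tr) (PartrecToTM2.init c (List.replicate k 1)) := by
      rw [h]; exact Part.mem_map _ (Part.mem_some _)
    obtain ⟨n, hn⟩ := StepsTo.exists_of_reaches (StateTransition.mem_eval.1 h').1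
    have := hsteps n _ _ (Finset.some_mem_insertNone.2 hmem) hn
    have hlab : lab (trNormal c Cont'.halt) = main := dif_pos hmem
    simp only [lift, liftCfg, PartrecToTM2.init, Option.elim, hlab] at this
    exact ⟨n, this⟩
  choose T hT using hrun
  refine ⟨s, inferInstance, main, M, T, fun l => ?_, ?_, hT⟩
  · exact (pushCount_liftStmt (Γ := fun _ => Γ') (κ := id) _).trans_le (pushCount_tr_le _)
  · let : Primcodable s := Primcodable.ofEquiv (Fin (Fintype.card s)) (Fintype.equivFin s)
    refine computable_time M (init := fun k => (some main, none, unaryStack k, [], [], []))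
      ?_ fun k => ⟨_, hT k, rfl⟩
    exact (Primrec.const _).pair ((Primrec.const _).pair (primrec_unaryStack.pair
      ((Primrec.const _).pair ((Primrec.const _).pair (Primrec.const _)))))

/-! ### A front end that prepares the input of a machine -/

/-- The stacks of a machine with a front end: those of the machine, those of the code that is run
by the front end, the input, a stash for the symbols to be passed on, and a clock. -/
inductive Stk (K : Type)
  | sim (k : K)
  | code (k : K')
  | inp
  | stash
  | clock
  deriving DecidableEq, Fintype

/-- The labels of a machine with a front end: one for each loop of the front end, and those of the
two machines that are run. -/
inductive Lab (Λ Λ' : Type)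
  | load
  | code (l : Λ')
  | decode
  | unstash
  | sim (l : Λ)
  deriving Fintype

/-- The memory of a machine with a front end: that of the two machines that are run, buffers for
symbols of the input, of the stash and of the clock, and a counter used in decoding. -/
structure Mem (σ G I : Type) (m : ℕ) where
  /-- the memory of the machine that is run in the end -/
  sim : σ
  /-- the memory of the code; also the last symbol read in decoding -/
  code : Option Γ'
  /-- the last symbol taken from the input -/
  inp : Option G
  /-- the last symbol taken from the stash -/
  buf : Option I
  /-- whether the clock was still running -/
  tick : Bool
  /-- the number of ones read in decoding since the last zero -/
  ones : Fin (m + 1)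
  deriving Fintype

/-- A front end for the machine `tm`, with input alphabet `G`. It reads its input and sorts the
symbols; runs a code on the number of `unit` symbols; decodes the result into a word; and then
starts `tm` on the symbols it has kept, followed by the reversal of that word. -/
structure FrontEnd (tm : FinTM2) (G : Type) where
  /-- the labels of the code -/
  Λ : Type
  [fin : Fintype Λ]
  /-- the first label of the code -/
  main : Λ
  /-- the code -/
  prog : Λ → TM2.Stmt (fun _ : K' => Γ') Λ (Option Γ')
  /-- the symbols that are kept as part of the input of `tm` -/
  keep : G → Option (tm.Γ tm.k₀)
  /-- the symbols that are counted for the argument of the code -/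
  isUnit : G → Bool
  /-- the symbols that are counted for the clock of the code -/
  isTick : G → Bool
  /-- the number of symbols in words that the code returns -/
  m : ℕ
  /-- the meaning of the symbols in words that the code returns -/
  dec : Fin (m + 1) → tm.Γ tm.k₀
  /-- the negative answer -/
  no : tm.Γ tm.k₁
  /-- whether the code is stopped, with a negative answer, when the clock has run out -/
  clocked : Bool

attribute [instance] FrontEnd.fin FinTM2.kFin FinTM2.ΛFin FinTM2.σFin FinTM2.Γk₀Fin

namespace FrontEnd

variable {tm : FinTM2} {G : Type} (E : FrontEnd tm G)

/-- The stack alphabets of a machine with a front end. -/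
@[reducible] def Γ (tm : FinTM2) (G : Type) : Stk tm.K → Type
  | .sim k => tm.Γ k
  | .code _ => Γ'
  | .inp => G
  | .stash => tm.Γ tm.k₀
  | .clock => Unit

/-- The memory of a machine with a front end. -/
abbrev Memory : Type := Mem tm.σ G (tm.Γ tm.k₀) E.m

/-- The labels of a machine with a front end. -/
abbrev Label : Type := Lab tm.Λ E.Λ

/-- The initial memory. -/
def mem₀ : E.Memory := ⟨tm.initialState, none, none, none, false, 0⟩

/-- Increment the counter of ones, unless it has reached its upper limit. -/
def incr {m : ℕ} (i : Fin (m + 1)) : Fin (m + 1) :=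
  if h : i.1 + 1 < m + 1 then ⟨i.1 + 1, h⟩ else i

open TM2.Stmt in
/-- The program of a machine with a front end.

* `load` empties the input. Each unit is written as the number `1`, that is `bit1, cons`, on the
  main stack of the code, so that this stack ends up holding a `unaryStack`.
* `code l` takes one symbol off the clock and does what the code does at `l`; where the code halts,
  the next label is `decode`.
* `decode` reads the value of the code, a binary number with the least significant digit first.
  A block of `d` ones and a zero is the symbol `d`, which goes to the input stack of `tm`. A block
  of ones at the end is dropped when the end marker `cons` appears. The word comes out reversed.
* `unstash` moves the stash to the input stack of `tm`. This restores the order of the stash,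
  which was reversed by `load`. Then `tm` is started.
* `sim l` does what `tm` does at `l`.

The default `E.dec 0` stands where a symbol is pushed only if it is present. -/
def program : E.Label → TM2.Stmt (Γ tm G) E.Label E.Memory
  | .load =>
    let pushKept : TM2.Stmt (Γ tm G) E.Label E.Memory :=
      branch (fun v => (v.inp.bind E.keep).isSome)
        (push .stash (fun v => (v.inp.bind E.keep).getD (E.dec 0)) (goto fun _ => .load))
        (goto fun _ => .load)
    let pushTick : TM2.Stmt (Γ tm G) E.Label E.Memory :=
      branch (fun v => v.inp.any E.isTick) (push .clock (fun _ => ()) pushKept) pushKept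
    pop .inp (fun v s => { v with inp := s }) <|
      branch (fun v => v.inp.isSome)
        (branch (fun v => v.inp.any E.isUnit)
          (push (.code .main) (fun _ => Γ'.cons) <| push (.code .main) (fun _ => Γ'.bit1) pushTick)
          pushTick)
        (goto fun _ => .code E.main)
  | .code l =>
    pop .clock (fun v s => { v with tick := s.isSome }) <|
      branch (fun v => !E.clocked || v.tick)
        (liftStmt (Γ tm G) Stk.code Mem.code (fun s v => { v with code := s }) Lab.code
          (some .decode) (E.prog l))
        (push (.sim tm.k₁) (fun _ => E.no) halt)
  | .decode =>
    pop (.code .main) (fun v s => { v with code := s }) <|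
      branch (fun v => v.code = some Γ'.bit1)
        (load (fun v => { v with ones := incr v.ones }) (goto fun _ => .decode)) <|
      branch (fun v => v.code = some Γ'.bit0)
        (push (.sim tm.k₀) (fun v => E.dec v.ones) <|
          load (fun v => { v with ones := 0 }) (goto fun _ => .decode))
        (goto fun _ => .unstash)
  | .unstash =>
    pop .stash (fun v s => { v with buf := s }) <|
      branch (fun v => v.buf.isSome)
        (push (.sim tm.k₀) (fun v => v.buf.getD (E.dec 0)) (goto fun _ => .unstash))
        (goto fun _ => .sim tm.main)
  | .sim l =>
    liftStmt (Γ tm G) Stk.sim Mem.sim (fun s v => { v with sim := s }) Lab.sim none (tm.m l)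

/-- The machine with a front end. -/
def machine [Fintype G] : FinTM2 where
  K := Stk tm.K
  k₀ := .inp
  k₁ := .sim tm.k₁
  Γ := Γ tm G
  Λ := E.Label
  main := .load
  σ := E.Memory
  initialState := E.mem₀
  Γk₀Fin := inferInstanceAs (Fintype G)
  m := E.program

/-- The stack contents of a machine with a front end, put together from their parts. -/
def allStk (S : ∀ k, List (tm.Γ k)) (C : K' → List Γ') (i : List G) (s : List (tm.Γ tm.k₀))
    (c : List Unit) : ∀ k, List (Γ tm G k)
  | .sim k => S k
  | .code k => C k
  | .inp => i
  | .stash => s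
  | .clock => c

section allStk

variable (S : ∀ k, List (tm.Γ k)) (C : K' → List Γ') (i : List G) (s : List (tm.Γ tm.k₀))
    (c : List Unit)

theorem update_sim (k : tm.K) (a : List (tm.Γ k)) :
    update (allStk S C i s c) (.sim k) a = allStk (update S k a) C i s c := by
  funext x
  cases x with
  | sim x =>
    by_cases h : x = k
    · subst h; simp [allStk]
    · simp [allStk, h]
  | _ => simp [allStk]

theorem update_code (k : K') (a : List Γ') :
    update (allStk S C i s c) (.code k) a = allStk S (update C k a) i s c := by
  funext x
  cases x with
  | code x =>
    by_cases h : x = k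
    · subst h; simp [allStk]
    · simp [allStk, h]
  | _ => simp [allStk]

theorem update_inp (a : List G) :
    update (allStk S C i s c) .inp a = allStk S C a s c := by
  funext x; cases x <;> simp [allStk]

theorem update_stash (a : List (tm.Γ tm.k₀)) :
    update (allStk S C i s c) .stash a = allStk S C i a c := by
  funext x; cases x <;> simp [allStk]

theorem update_clock (a : List Unit) :
    update (allStk S C i s c) .clock a = allStk S C i s a := by
  funext x; cases x <;> simp [allStk]

end allStk

theorem step_load (v : E.Memory) (S) (j : ℕ) (g : G) (w : List G) (s) (c : List Unit) :
    TM2.step E.program ⟨some .load, v, allStk S (K'.elim (unaryStack j) [] [] []) (g :: w) s c⟩ =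
      some ⟨some .load, { v with inp := some g },
        allStk S (K'.elim (unaryStack (j + if E.isUnit g then 1 else 0)) [] [] []) w
          ((E.keep g).toList ++ s) (List.replicate (if E.isTick g then 1 else 0) () ++ c)⟩ := by
  simp only [TM2.step, program, TM2.stepAux, update_inp, update_code, update_clock, update_stash,
    allStk]
  cases h₁ : E.isUnit g <;> cases h₂ : E.isTick g <;> cases h₃ : E.keep g <;>
    simp [h₁, h₂, h₃, unaryStack_succ]

/-- Loading sorts the input: units go to the code, ticks to the clock, and kept symbols, reversed,
to the stash. -/
theorem stepsTo_load (v : E.Memory) (S) (j : ℕ) (w : List G) (s) (c : ℕ) :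
    StepsTo (TM2.step E.program) (w.length + 1)
      ⟨some .load, v, allStk S (K'.elim (unaryStack j) [] [] []) w s (List.replicate c ())⟩
      ⟨some (.code E.main), { v with inp := none },
        allStk S (K'.elim (unaryStack (j + w.countP E.isUnit)) [] [] []) []
          ((w.filterMap E.keep).reverse ++ s) (List.replicate (c + w.countP E.isTick) ())⟩ := by
  induction w generalizing v j s c with
  | nil =>
    refine StepsTo.single ?_
    simp [TM2.step, program, TM2.stepAux, update_inp, allStk]
  | cons g w ih =>
    refine StepsTo.head (E.step_load v S j g w s _) ?_
    have h := ih { v with inp := some g } (j + if E.isUnit g then 1 else 0)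
      ((E.keep g).toList ++ s) ((if E.isTick g then 1 else 0) + c)
    rw [List.replicate_add] at h
    have e₁ : j + (g :: w).countP E.isUnit =
        j + (if E.isUnit g then 1 else 0) + w.countP E.isUnit := by
      rw [List.countP_cons]; omega
    have e₂ : c + (g :: w).countP E.isTick =
        (if E.isTick g then 1 else 0) + c + w.countP E.isTick := by
      rw [List.countP_cons]; omega
    have e₃ : ((g :: w).filterMap E.keep).reverse ++ s =
        (w.filterMap E.keep).reverse ++ ((E.keep g).toList ++ s) := by
      cases hk : E.keep g <;> simp [hk]
    rw [e₁, e₂, e₃]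
    exact h

theorem step_code {l : E.Λ} {x : Option Γ'} {C : K' → List Γ'} {d}
    (h : TM2.step E.prog ⟨some l, x, C⟩ = some d) (v : E.Memory) (S) (i s) (c : List Unit)
    (hc : E.clocked = true → c ≠ []) :
    TM2.step E.program ⟨some (.code l), { v with code := x }, allStk S C i s c⟩ =
      some ⟨d.l.elim (some .decode) fun l => some (.code l),
        { v with code := d.var, tick := c.head?.isSome }, allStk S d.stk i s c.tail⟩ := by
  simp only [TM2.step, Option.some.injEq] at h
  subst h
  have hlift := stepAux_liftStmt (Γ := Γ tm G) (κ := Stk.code) (get := Mem.code)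
    (set := fun s v => { v with code := s }) (Lab.code : E.Λ → E.Label) (some .decode)
    (fun _ _ => rfl) (fun _ _ _ => rfl) (emb := fun C => allStk S C i s c.tail)
    (fun _ _ => rfl) (fun C k a => update_code S C i s c.tail k a)
    { v with tick := c.head?.isSome } (E.prog l) x C
  simp only [TM2.step, program, TM2.stepAux, Option.some.injEq, update_clock]
  have hcond : (!E.clocked || (allStk (tm := tm) S C i s c .clock).head?.isSome) = true := by
    cases hE : E.clocked
    · rfl
    · obtain ⟨a, c, rfl⟩ := List.exists_cons_of_ne_nil (hc hE)
      rfl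
  rw [hcond]
  exact hlift

/-- As long as the clock allows it, the front end simulates the code step by step. -/
theorem stepsTo_code {n : ℕ} {a b : TM2.Cfg (fun _ : K' => Γ') E.Λ (Option Γ')}
    (h : StepsTo (TM2.step E.prog) n a b) (v : E.Memory) (S) (i s) (c : List Unit)
    (hc : E.clocked = true → n ≤ c.length) :
    ∃ t, StepsTo (TM2.step E.program) n
      ⟨a.l.elim (some .decode) fun l => some (.code l), { v with code := a.var },
        allStk S a.stk i s c⟩
      ⟨b.l.elim (some .decode) fun l => some (.code l), { v with code := b.var, tick := t },
        allStk S b.stk i s (c.drop n)⟩ := by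
  induction n generalizing a v c with
  | zero =>
    obtain rfl := StepsTo.unique h (StepsTo.refl a)
    exact ⟨v.tick, StepsTo.refl _⟩
  | succ n ih =>
    obtain ⟨d, hd, hn⟩ := StepsTo.succ_iff.1 h
    obtain ⟨_ | l, x, C⟩ := a
    · simp at hd
    · have h₁ := E.step_code hd v S i s c
        (fun hE h₀ => by have := hc hE; simp [h₀] at this)
      obtain ⟨t, ht⟩ := ih hn { v with tick := c.head?.isSome } c.tail
        (fun hE => by have := hc hE; simp; omega)
      rw [List.drop_tail] at ht
      exact ⟨t, StepsTo.head h₁ ht⟩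

/-- If the clock runs out, the answer is negative. -/
theorem stepsTo_reject {n : ℕ} {a b : TM2.Cfg (fun _ : K' => Γ') E.Λ (Option Γ')}
    (h : StepsTo (TM2.step E.prog) n a b) (v : E.Memory) (S) (i s) (c : List Unit)
    (hE : E.clocked = true) (hc : c.length < n) :
    ∃ d, StepsTo (TM2.step E.program) (c.length + 1)
      ⟨a.l.elim (some .decode) fun l => some (.code l), { v with code := a.var },
        allStk S a.stk i s c⟩ d ∧ d.l = none ∧ (d.stk (.sim tm.k₁)).head? = some E.no := by
  obtain ⟨b', hb'⟩ := h.exists_of_le hc.le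
  obtain ⟨e, he⟩ := h.exists_next hb' hc
  obtain ⟨t, ht⟩ := E.stepsTo_code hb' v S i s c (fun _ => le_rfl)
  obtain ⟨_ | l, x, C⟩ := b'
  · simp at he
  · refine ⟨_, ht.trans (StepsTo.single rfl), ?_⟩
    simp [program, hE, allStk, TM2.stepAux, update_clock, update_sim]

/-- A block of ones is counted, unless it is too long to be part of a symbol. -/
theorem stepsTo_decode_ones (v : E.Memory) (S) (L : ℕ) (C : List Γ') (s) (c : List Unit) :
    ∃ v' : E.Memory, v'.sim = v.sim ∧ (v.ones + L ≤ E.m → v'.ones.1 = v.ones + L) ∧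
      StepsTo (TM2.step E.program) L
        ⟨some .decode, v,
          allStk S (K'.elim (List.replicate L Γ'.bit1 ++ C) [] [] []) [] s c⟩
        ⟨some .decode, v', allStk S (K'.elim C [] [] []) [] s c⟩ := by
  induction L generalizing v with
  | zero => exact ⟨v, rfl, fun _ => rfl, StepsTo.refl _⟩
  | succ L ih =>
    obtain ⟨v', hs, ho, h⟩ := ih { v with code := some Γ'.bit1, ones := incr v.ones }
    refine ⟨v', hs, fun hL => ?_, StepsTo.head ?_ h⟩
    · have hi : (incr v.ones).1 = v.ones.1 + 1 := by
        rw [incr, dif_pos (by omega)]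
      change (incr v.ones).1 + L ≤ E.m → v'.ones.1 = (incr v.ones).1 + L at ho
      omega
    · simp [program, TM2.step, TM2.stepAux, allStk, update_code, List.replicate_succ]

/-- The symbol `d` of a word is written as `d` ones, followed by a zero; the word is followed by
`L` further ones. -/
def wordBits {m : ℕ} (w : List (Fin m)) (L : ℕ) : List Γ' :=
  w.flatMap (fun d : Fin m => List.replicate d.1 Γ'.bit1 ++ [Γ'.bit0]) ++ List.replicate L Γ'.bit1

theorem stepsTo_decode (v : E.Memory) (hv : v.ones = 0) (S) (w : List (Fin E.m)) (L : ℕ)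
    (r : List (tm.Γ tm.k₀)) (s) (c : List Unit) :
    ∃ v' : E.Memory, v'.sim = v.sim ∧
      StepsTo (TM2.step E.program) ((wordBits w L).length + 1)
        ⟨some .decode, v,
          allStk (update S tm.k₀ r) (K'.elim (wordBits w L ++ [Γ'.cons]) [] [] []) [] s c⟩
        ⟨some .unstash, v', allStk (update S tm.k₀ ((w.map fun d => E.dec d.castSucc).reverse ++ r))
          (K'.elim [] [] [] []) [] s c⟩ := by
  induction w generalizing v r with
  | nil =>
    obtain ⟨v', hs, -, h⟩ := E.stepsTo_decode_ones v (update S tm.k₀ r) L [Γ'.cons] s c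
    refine ⟨{ v' with code := some Γ'.cons }, hs, ?_⟩
    simp only [wordBits, List.flatMap_nil, List.nil_append, List.length_replicate]
    refine h.trans (StepsTo.single ?_)
    simp [program, TM2.step, TM2.stepAux, allStk, update_code]
  | cons d w ih =>
    obtain ⟨v', hs, ho, h⟩ := E.stepsTo_decode_ones v (update S tm.k₀ r) d
      (Γ'.bit0 :: (wordBits w L ++ [Γ'.cons])) s c
    have hd : v'.ones = d.castSucc := by
      apply Fin.ext
      have hd := d.2
      rw [hv] at ho
      have h₀ : ((0 : Fin (E.m + 1)) : ℕ) = 0 := rfl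
      rw [ho (by omega), h₀, Nat.zero_add]
      rfl
    obtain ⟨v'', hs', h'⟩ := ih { v' with code := some Γ'.bit0, ones := 0 } rfl
      (E.dec d.castSucc :: r)
    refine ⟨v'', hs'.trans hs, ?_⟩
    have e₁ : (wordBits (d :: w) L).length + 1 = d + (((wordBits w L).length + 1) + 1) := by
      simp [wordBits]; omega
    have e₂ : wordBits (d :: w) L ++ [Γ'.cons] =
        List.replicate d Γ'.bit1 ++ (Γ'.bit0 :: (wordBits w L ++ [Γ'.cons])) := by
      simp [wordBits]
    have e₃ : ((d :: w).map fun d => E.dec d.castSucc).reverse ++ r =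
        (w.map fun d => E.dec d.castSucc).reverse ++ (E.dec d.castSucc :: r) := by
      simp
    rw [e₁, e₂, e₃]
    refine h.trans (StepsTo.head ?_ h')
    simp [program, TM2.step, TM2.stepAux, allStk, update_code, update_sim, hd]

theorem stepsTo_unstash (v : E.Memory) (S C) (s r : List (tm.Γ tm.k₀)) (c : List Unit) :
    ∃ v' : E.Memory, v'.sim = v.sim ∧
      StepsTo (TM2.step E.program) (s.length + 1)
        ⟨some .unstash, v, allStk (update S tm.k₀ r) C [] s c⟩
        ⟨some (.sim tm.main), v', allStk (update S tm.k₀ (s.reverse ++ r)) C [] [] c⟩ := by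
  induction s generalizing v r with
  | nil =>
    refine ⟨{ v with buf := none }, rfl, StepsTo.single ?_⟩
    simp [program, TM2.step, TM2.stepAux, allStk, update_stash]
  | cons a s ih =>
    obtain ⟨v', hs, h⟩ := ih { v with buf := some a } (a :: r)
    rw [List.reverse_cons, List.append_assoc, List.singleton_append]
    refine ⟨v', hs, StepsTo.head ?_ h⟩
    simp [program, TM2.step, TM2.stepAux, allStk, update_stash, update_sim]

theorem stepsTo_sim {n : ℕ} {a b : TM2.Cfg tm.Γ tm.Λ tm.σ}
    (h : StepsTo (TM2.step tm.m) n a b) (v : E.Memory) (C i s) (c : List Unit) :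
    StepsTo (TM2.step E.program) n
      ⟨a.l.map .sim, { v with sim := a.var }, allStk a.stk C i s c⟩
      ⟨b.l.map .sim, { v with sim := b.var }, allStk b.stk C i s c⟩ := by
  induction n generalizing a with
  | zero =>
    obtain rfl := StepsTo.unique h (StepsTo.refl a)
    exact StepsTo.refl _
  | succ n ih =>
    obtain ⟨d, hd, hn⟩ := StepsTo.succ_iff.1 h
    obtain ⟨_ | l, x, S⟩ := a
    · simp at hd
    · refine StepsTo.head ?_ (ih hn)
      simp only [TM2.step, Option.some.injEq] at hd
      subst hd
      have hlift := stepAux_liftStmt (Γ := Γ tm G) (κ := Stk.sim) (get := Mem.sim)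
        (set := fun s v => { v with sim := s }) (Lab.sim : tm.Λ → E.Label) none
        (fun _ _ => rfl) (fun _ _ _ => rfl) (emb := fun S => allStk S C i s c)
        (fun _ _ => rfl) (fun S k a => update_sim S C i s c k a) v (tm.m l) x S
      refine (congrArg some hlift).trans ?_
      generalize TM2.stepAux (tm.m l) x S = d
      obtain ⟨_ | _, _, _⟩ := d <;> rfl

end FrontEnd

/-! ### Runs of a machine with a front end -/

theorem initList_eq (tm : FinTM2) (r : List (tm.Γ tm.k₀)) :
    initList tm r = ⟨some tm.main, tm.initialState, update (fun _ => []) tm.k₀ r⟩ := by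
  unfold initList
  congr 1
  funext k
  by_cases h : k = tm.k₀
  · subst h; simp
  · simp [h]

namespace FrontEnd

variable {tm : FinTM2} {G : Type} [Fintype G] (E : FrontEnd tm G)

/-- The initial configuration, with the empty clock and the empty unary stack written in the form
that `stepsTo_load` expects. -/
theorem initList_machine (w : List G) :
    initList E.machine w =
      (⟨some .load, E.mem₀, allStk (fun _ => []) (K'.elim (unaryStack 0) [] [] []) w []
        (List.replicate 0 ())⟩ : TM2.Cfg (Γ tm G) E.Label E.Memory) := by
  unfold initList
  congr 1
  funext k
  cases k with
  | inp => rfl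
  | code k => cases k <;> rfl
  | _ => rfl

/-- The run of a machine with a front end when the clock does not run out. -/
theorem exists_stepsTo {w : List G} {k : ℕ} (hk : w.countP E.isUnit = k) {T : ℕ}
    {u : List (Fin E.m)} {L : ℕ}
    (hcode : StepsTo (TM2.step E.prog) T
      ⟨some E.main, none, K'.elim (unaryStack k) [] [] []⟩
      ⟨none, none, K'.elim (wordBits u L ++ [Γ'.cons]) [] [] []⟩)
    (hclock : E.clocked = true → T ≤ w.countP E.isTick) {t : ℕ} {c : tm.Cfg}
    (hsim : StepsTo tm.step t
      (initList tm (w.filterMap E.keep ++ (u.map fun d => E.dec d.castSucc).reverse)) c)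
    (hc : c.l = none) :
    ∃ d : E.machine.Cfg, StepsTo E.machine.step
        ((w.length + 1) + (T + (((wordBits u L).length + 1) +
          (((w.filterMap E.keep).length + 1) + t)))) (initList E.machine w) d ∧
      d.l = none ∧ d.stk E.machine.k₁ = c.stk tm.k₁ := by
  have h₁ := E.stepsTo_load E.mem₀ (fun _ => []) 0 w [] 0
  rw [← initList_machine, Nat.zero_add, List.append_nil, hk] at h₁
  obtain ⟨tick, h₂⟩ := E.stepsTo_code hcode { E.mem₀ with inp := none } (fun _ => []) []
    (w.filterMap E.keep).reverse (List.replicate (0 + w.countP E.isTick) ())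
    (by simpa using hclock)
  -- `stepsTo_decode` wants the empty stacks of `tm` with the input stack singled out.
  have hS : (fun _ => [] : ∀ k, List (tm.Γ k)) = update (fun _ => []) tm.k₀ [] := by simp
  obtain ⟨v₃, hv₃, h₃⟩ := E.stepsTo_decode
    { E.mem₀ with inp := none, code := none, tick := tick } rfl (fun _ => []) u L []
    (w.filterMap E.keep).reverse (List.drop T (List.replicate (0 + w.countP E.isTick) ()))
  rw [← hS] at h₃
  obtain ⟨v₄, hv₄, h₄⟩ := E.stepsTo_unstash v₃ (fun _ => []) (K'.elim [] [] [] [])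
    (w.filterMap E.keep).reverse ((u.map fun d => E.dec d.castSucc).reverse ++ [])
    (List.drop T (List.replicate (0 + w.countP E.isTick) ()))
  rw [List.reverse_reverse, List.length_reverse, List.append_nil] at h₄
  rw [initList_eq] at hsim
  have h₅ := E.stepsTo_sim hsim v₄ (K'.elim [] [] [] []) [] []
    (List.drop T (List.replicate (0 + w.countP E.isTick) ()))
  have hv : { v₄ with sim := tm.initialState } = v₄ := by
    have : v₄.sim = tm.initialState := hv₄.trans hv₃
    rw [← this]
  simp only [hv] at h₅
  rw [List.append_nil] at h₃
  refine ⟨_, h₁.trans (h₂.trans (h₃.trans (h₄.trans h₅))), ?_, rfl⟩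
  change c.l.map _ = none
  rw [hc]; rfl

/-- The run of a machine with a front end when the clock runs out. -/
theorem exists_stepsTo_of_lt {w : List G} {k : ℕ} (hk : w.countP E.isUnit = k) {T : ℕ} {b}
    (hcode : StepsTo (TM2.step E.prog) T
      ⟨some E.main, none, K'.elim (unaryStack k) [] [] []⟩ b)
    (hE : E.clocked = true) (hclock : w.countP E.isTick < T) :
    ∃ d : E.machine.Cfg, StepsTo E.machine.step ((w.length + 1) + (w.countP E.isTick + 1))
        (initList E.machine w) d ∧
      d.l = none ∧ (d.stk E.machine.k₁).head? = some E.no := by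
  have h₁ := E.stepsTo_load E.mem₀ (fun _ => []) 0 w [] 0
  rw [← initList_machine, Nat.zero_add, List.append_nil, hk] at h₁
  obtain ⟨d, h₂, hd⟩ := E.stepsTo_reject hcode { E.mem₀ with inp := none } (fun _ => []) []
    (w.filterMap E.keep).reverse (List.replicate (0 + w.countP E.isTick) ()) hE
    (by simpa using hclock)
  have hlen : (List.replicate (0 + w.countP E.isTick) ()).length = w.countP E.isTick := by simp
  rw [hlen] at h₂
  exact ⟨d, h₁.trans h₂, hd⟩

end FrontEnd

/-! ### Words as numbers -/

/-- The number with binary expansion `wordBits w L`, least significant digit first. -/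
def wordNum {m : ℕ} (w : List (Fin m)) (L : ℕ) : ℕ :=
  w.foldr (fun d n => 2 ^ d.1 - 1 + 2 ^ (d.1 + 1) * n) (2 ^ L - 1)

theorem trNat_ones_zero (d : ℕ) {n : ℕ} (hn : 0 < n) :
    trNat (2 ^ d - 1 + 2 ^ (d + 1) * n) =
      List.replicate d Γ'.bit1 ++ Γ'.bit0 :: trNat n := by
  induction d with
  | zero => simp [trNat_two_mul hn]
  | succ d ih =>
    have h : 2 ^ (d + 1) - 1 + 2 ^ (d + 1 + 1) * n = 2 * (2 ^ d - 1 + 2 ^ (d + 1) * n) + 1 := by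
      have h₁ := Nat.one_le_two_pow (n := d)
      have h₂ : 2 ^ (d + 1 + 1) * n = 2 * (2 ^ (d + 1) * n) := by ring
      rw [h₂, pow_succ]
      omega
    rw [h, trNat_two_mul_add_one, ih, List.replicate_succ, List.cons_append]

theorem trNat_wordNum {m : ℕ} (w : List (Fin m)) {L : ℕ} (hL : 0 < L) :
    trNat (wordNum w L) = FrontEnd.wordBits w L := by
  have key : 0 < wordNum w L ∧ trNat (wordNum w L) = FrontEnd.wordBits w L := by
    induction w with
    | nil =>
      refine ⟨?_, by simp [wordNum, FrontEnd.wordBits, trNat_two_pow_sub_one]⟩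
      have := Nat.one_lt_two_pow hL.ne'
      simp [wordNum]; omega
    | cons d w ih =>
      have e : wordNum (d :: w) L = 2 ^ d.1 - 1 + 2 ^ (d.1 + 1) * wordNum w L := rfl
      rw [e, trNat_ones_zero _ ih.1, ih.2]
      refine ⟨Nat.add_pos_right _ (Nat.mul_pos (by positivity) ih.1), ?_⟩
      simp [FrontEnd.wordBits]
  exact key.2

theorem primrec_wordNum (m L : ℕ) : Primrec fun w : List (Fin m) => wordNum w L := by
  have h : Primrec₂ fun (_ : List (Fin m)) (p : Fin m × ℕ) =>
      2 ^ p.1.1 - 1 + 2 ^ (p.1.1 + 1) * p.2 := by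
    have hp : Primrec fun q : List (Fin m) × (Fin m × ℕ) => q.2.1 := Primrec.fst.comp Primrec.snd
    exact Primrec.nat_add.comp ((Primrec.dom_finite fun d : Fin m => 2 ^ d.1 - 1).comp hp)
      (Primrec.nat_mul.comp ((Primrec.dom_finite fun d : Fin m => 2 ^ (d.1 + 1)).comp hp)
        (Primrec.snd.comp Primrec.snd))
  exact Primrec.list_foldr Primrec.id (Primrec.const _) h

/-! ### Some primitive recursive functions -/

theorem primrec_two_pow : Primrec fun n : ℕ => 2 ^ n := by
  have h : Primrec fun n : ℕ => Nat.rec (motive := fun _ => ℕ) 1 (fun _ r => r * 2) n :=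
    Primrec.nat_rec' Primrec.id (Primrec.const 1)
      (Primrec.nat_mul.comp (Primrec.snd.comp Primrec.snd) (Primrec.const 2)).to₂
  refine h.of_eq fun n => ?_
  induction n with
  | zero => rfl
  | succ n ih => rw [pow_succ, ← ih]

theorem primrec_factorial : Primrec Nat.factorial := by
  have h : Primrec fun n : ℕ => Nat.rec (motive := fun _ => ℕ) 1 (fun k r => (k + 1) * r) n :=
    Primrec.nat_rec' Primrec.id (Primrec.const 1)
      (Primrec.nat_mul.comp (Primrec.succ.comp (Primrec.fst.comp Primrec.snd))
        (Primrec.snd.comp Primrec.snd)).to₂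
  refine h.of_eq fun n => ?_
  induction n with
  | zero => rfl
  | succ n ih => rw [Nat.factorial_succ, ← ih]

theorem primrec_pow_const (c : ℕ) : Primrec fun n : ℕ => n ^ c := by
  induction c with
  | zero => exact (Primrec.const 1).of_eq fun n => by simp
  | succ c ih => exact (Primrec.nat_mul.comp ih Primrec.id).of_eq fun n => by simp [pow_succ]

theorem primrec_replicate {α : Type} [Primcodable α] (a : α) :
    Primrec fun n : ℕ => List.replicate n a := by
  have h : Primrec fun n : ℕ => Nat.rec (motive := fun _ => List α) [] (fun _ r => a :: r) n :=
    Primrec.nat_rec' Primrec.id (Primrec.const [])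
      (Primrec.list_cons.comp (Primrec.const a) (Primrec.snd.comp Primrec.snd)).to₂
  refine h.of_eq fun n => ?_
  induction n with
  | zero => rfl
  | succ n ih => rw [List.replicate_succ, ← ih]

/-! ### Decision problems -/

section Decide

variable {α Γ : Type} {enc : α → List Γ} {P : Set α} {T T' : α → ℕ}

theorem DecidedInTime.mono (h : DecidedInTime enc P T) (hT : ∀ a, T a ≤ T' a) :
    DecidedInTime enc P T' := by
  obtain ⟨M, hM⟩ := h
  refine ⟨M, fun a => ?_⟩
  obtain ⟨c, ⟨h⟩, hc⟩ := hM a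
  exact ⟨c, ⟨⟨h.toEvalsTo, h.steps_le_m.trans (hT a)⟩⟩, hc⟩

/-- `DecidedInTime` in terms of `StepsTo`. -/
theorem decidedInTime_iff : DecidedInTime enc P T ↔ ∃ M : TM2ComputableAux Γ Bool, ∀ a,
    ∃ t ≤ T a, ∃ c, StepsTo M.tm.step t
      (initList M.tm ((enc a).map M.inputAlphabet.symm)) c ∧ c.l = none ∧
      ∃ answer : Bool, (c.stk M.tm.k₁).head?.map M.outputAlphabet = some answer ∧
        (answer = true ↔ a ∈ P) := by
  refine exists_congr fun M => forall_congr' fun a => ⟨?_, ?_⟩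
  · rintro ⟨c, ⟨h⟩, hc⟩
    exact ⟨h.steps, h.steps_le_m, c, h.evals_in_steps, hc⟩
  · rintro ⟨t, ht, c, h, hc⟩
    exact ⟨c, h.evalsToInTime ht, hc⟩

end Decide

variable {A : Type}

/-! ### Front ends for decision problems -/

/-- A front end for a machine `M` that decides a problem. It keeps the symbols that `sym`
translates to input symbols of `M`. -/
def mkFrontEnd {I G : Type} (M : TM2ComputableAux I Bool) (Λ : Type) [Fintype Λ] (main : Λ)
    (prog : Λ → TM2.Stmt (fun _ : K' => Γ') Λ (Option Γ')) (sym : G → Option I)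
    (isUnit isTick : G → Bool) (m : ℕ) (dec : Fin (m + 1) → I) (clocked : Bool) :
    FrontEnd M.tm G where
  Λ := Λ
  main := main
  prog := prog
  keep g := (sym g).map M.inputAlphabet.symm
  isUnit := isUnit
  isTick := isTick
  m := m
  dec i := M.inputAlphabet.symm (dec i)
  no := M.outputAlphabet.symm false
  clocked := clocked

/-- The machine with a front end, with its alphabets. -/
def FrontEnd.aux {I G : Type} [Fintype G] (M : TM2ComputableAux I Bool) (E : FrontEnd M.tm G) :
    TM2ComputableAux G Bool where
  tm := E.machine
  inputAlphabet := Equiv.refl G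
  outputAlphabet := M.outputAlphabet

theorem FrontEnd.initList_aux {I G : Type} [Fintype G] (M : TM2ComputableAux I Bool)
    (E : FrontEnd M.tm G) (w : List G) :
    initList (E.aux M).tm (w.map (E.aux M).inputAlphabet.symm) = initList E.machine w :=
  congrArg (initList E.machine) (List.map_id w)

theorem length_inputWord {D : Type} (x : List A) (n : ℕ) (y : List D) :
    (inputWord x n y).length = x.length + n + y.length + 2 := by
  simp [inputWord]; omega

theorem inputWord_eq_append {D : Type} (x : List A) (n : ℕ) (y : List D) :
    inputWord x n y = inputWord x n [] ++ y.map fun d => .inr (.inl d) := by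
  simp [inputWord]

theorem filterMap_inputWord {D D' : Type} {sym : A ⊕ D ⊕ Bool → Option (A ⊕ D' ⊕ Bool)}
    (h₁ : ∀ a, sym (.inl a) = some (.inl a)) (h₂ : ∀ b, sym (.inr (.inr b)) = some (.inr (.inr b)))
    (x : List A) (n : ℕ) (y : List D) :
    (inputWord x n y).filterMap sym =
      inputWord x n [] ++ y.filterMap fun d => sym (.inr (.inl d)) := by
  have hx : (x.map Sum.inl).filterMap sym = x.map .inl := by
    induction x with
    | nil => rfl
    | cons a x ih => simp only [List.map_cons, List.filterMap_cons, h₁, ih]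
  have hn : (List.replicate n (.inr (.inr true))).filterMap sym =
      List.replicate n (.inr (.inr true)) := by
    induction n with
    | zero => rfl
    | succ n ih => simp only [List.replicate_succ, List.filterMap_cons, h₂, ih]
  have hy : (y.map fun d => .inr (.inl d)).filterMap sym =
      y.filterMap fun d => sym (.inr (.inl d)) := List.filterMap_map
  simp only [inputWord, List.filterMap_append, List.filterMap_cons, hx, hn, hy, h₂]
  simp

/-! ### From **para-E** to **FPE** -/

section ParaE

variable {m : ℕ}

/-- Keep everything except the coarse-grained parameter. -/
def keepFine : A ⊕ Unit ⊕ Bool → Option (A ⊕ Fin m ⊕ Bool)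
  | .inl a => some (.inl a)
  | .inr (.inl _) => none
  | .inr (.inr b) => some (.inr (.inr b))

/-- Is the symbol a unit of the coarse-grained parameter? -/
def isCoarse : A ⊕ Unit ⊕ Bool → Bool
  | .inr (.inl _) => true
  | _ => false

/-- The symbol of number `i`; the number `m`, which occurs in no word, has an arbitrary value. -/
def symbol (i : Fin (m + 1)) : A ⊕ Fin m ⊕ Bool :=
  if h : i.1 < m then .inr (.inl ⟨i, h⟩) else .inr (.inr false)

theorem filterMap_keepFine (x : List A) (n k : ℕ) (y : List (Fin m)) :
    (encodeBi (x, n, k)).filterMap keepFine ++ y.map (fun d => symbol d.castSucc) =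
      encodeWord (x, n, y) := by
  have h₁ : (List.replicate k ()).filterMap
      (fun u => keepFine (.inr (.inl u) : A ⊕ Unit ⊕ Bool) (m := m)) = [] := by simp [keepFine]
  have h₂ : (fun d : Fin m => (symbol d.castSucc : A ⊕ Fin m ⊕ Bool)) = fun d => .inr (.inl d) := by
    funext d
    simp [symbol]
  rw [encodeBi, encodeWord, filterMap_inputWord (sym := keepFine) (fun _ => rfl) (fun _ => rfl),
    h₁, h₂, List.append_nil, ← inputWord_eq_append]

theorem countP_isCoarse (x : List A) (n k : ℕ) :
    (encodeBi (x, n, k)).countP isCoarse = k := by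
  simp [encodeBi, inputWord, isCoarse, List.countP_map, List.countP_replicate, comp_def]

/-- The time of the front end and of the machine for **E**, together. -/
theorem paraE_time_le (a b c n k T l X t : ℕ) (ht : t ≤ 2 ^ (a * n + b) * (X + l + 1) ^ c) :
    (X + n + k + 3) + (T + ((2 * k + 2 * T) + ((X + n + 3) + t))) ≤
      (3 * k + 3 * T + 8 + (l + 1) ^ c) * 2 ^ ((a + 1) * n + b) * (X + 1) ^ (c + 1) := by
  have hE : n + 1 ≤ 2 ^ n := Nat.lt_two_pow_self
  have hW : 1 ≤ 2 ^ (a * n + b) := Nat.one_le_two_pow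
  have hP : 1 ≤ (X + 1) ^ c := Nat.one_le_pow _ _ (by omega)
  have h₁ : (X + l + 1) ^ c ≤ (X + 1) ^ c * (l + 1) ^ c := by
    rw [← mul_pow]
    exact Nat.pow_le_pow_left (by nlinarith) c
  have e : 2 ^ ((a + 1) * n + b) = 2 ^ (a * n + b) * 2 ^ n := by rw [← pow_add]; congr 1; ring
  rw [e, pow_succ]
  generalize 2 ^ n = E at *
  generalize 2 ^ (a * n + b) = W at *
  generalize (X + 1) ^ c = P at *
  generalize (l + 1) ^ c = R at *
  have h₂ : t ≤ W * P * R := ht.trans (by rw [mul_assoc]; exact Nat.mul_le_mul_left _ h₁)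
  have h₃ : X + n + 1 ≤ E * (X + 1) := by nlinarith
  have h₄ : 1 ≤ W * P := Nat.mul_pos hW hP
  have h₅ : 1 ≤ E * (X + 1) := by omega
  calc _ ≤ (3 * k + 3 * T + 8) * (E * (X + 1)) + W * P * R := by nlinarith
    _ ≤ (3 * k + 3 * T + 8) * (E * (X + 1)) * (W * P) + W * P * R * (E * (X + 1)) :=
      Nat.add_le_add (Nat.le_mul_of_pos_right _ h₄) (Nat.le_mul_of_pos_right _ h₅)
    _ = _ := by ring

end ParaE

/-- The machine for **FPE** computes `π k` from `k`, and then runs the machine for **E**. -/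
theorem InParaE.inFPE [Finite A] {P : Set (List A × ℕ × ℕ)} (h : InParaE P) : InFPE P := by
  have := Fintype.ofFinite A
  obtain ⟨m, π, Q, hπ, ⟨a, b, c, hQ⟩, hPQ⟩ := h
  obtain ⟨M, hM⟩ := decidedInTime_iff.1 hQ
  -- The front end reverses the words that it decodes.
  have hg : Computable fun k => wordNum (π k).reverse 1 :=
    (primrec_wordNum m 1).to_comp.comp (Primrec.list_reverse.to_comp.comp hπ)
  obtain ⟨Λ, _, main, prog, T, hpush, hT, hrun⟩ := exists_finite_machine hg
  refine ⟨fun k => 3 * k + 3 * T k + 8 + ((π k).length + 1) ^ c, ?_, a + 1, b, c + 1, ?_⟩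
  · have h₁ : Primrec₂ fun k t : ℕ => 3 * k + 3 * t + 8 :=
      Primrec.nat_add.comp (Primrec.nat_add.comp
        (Primrec.nat_mul.comp (Primrec.const 3) Primrec.fst)
        (Primrec.nat_mul.comp (Primrec.const 3) Primrec.snd)) (Primrec.const 8)
    have h₂ : Computable fun k => ((π k).length + 1) ^ c :=
      (primrec_pow_const c).to_comp.comp
        (Primrec.succ.to_comp.comp (Primrec.list_length.to_comp.comp hπ))
    exact Primrec.nat_add.to_comp.comp (h₁.to_comp.comp Computable.id hT) h₂
  let E : FrontEnd M.tm (A ⊕ Unit ⊕ Bool) :=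
    mkFrontEnd M Λ main prog keepFine isCoarse (fun _ => false) m symbol false
  refine decidedInTime_iff.2 ⟨E.aux M, ?_⟩
  rintro ⟨x, n, k⟩
  obtain ⟨t, ht, d, hd, hl, ans, hans, hiff⟩ := hM (x, n, π k)
  have hbits : trList [wordNum (π k).reverse 1] =
      FrontEnd.wordBits (π k).reverse 1 ++ [Γ'.cons] := by
    simp [trList, trNat_wordNum _ Nat.one_pos]
  have hlen := length_stk_le_of_stepsTo hpush K'.main (hrun k)
  simp only [K'.elim, hbits, length_unaryStack, List.length_append, List.length_singleton] at hlen
  have hcode := hrun k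
  rw [hbits] at hcode
  have hkeep : (encodeBi (x, n, k)).filterMap E.keep ++
      ((π k).reverse.map fun d => E.dec d.castSucc).reverse =
      (encodeWord (x, n, π k)).map M.inputAlphabet.symm := by
    rw [← filterMap_keepFine x n k, List.map_append, List.map_filterMap, List.map_map,
      ← List.map_reverse, List.reverse_reverse]
    rfl
  rw [← hkeep] at hd
  obtain ⟨d', hd', hl', hk'⟩ := E.exists_stepsTo (countP_isCoarse x n k) hcode
    (fun h => absurd h Bool.false_ne_true) hd hl
  refine ⟨_, ?_, d', (E.initList_aux M _).symm ▸ hd', hl', ans, ?_, hiff.trans (hPQ x n k).symm⟩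
  · have h₁ : (encodeBi (x, n, k)).length = x.length + n + k + 2 := by
      simp [encodeBi, length_inputWord]
    have h₂ : ((encodeBi (x, n, k)).filterMap E.keep).length + (π k).length =
        x.length + n + (π k).length + 2 := by
      have := congrArg List.length hkeep
      simpa [encodeWord, length_inputWord] using this
    refine le_trans ?_ (paraE_time_le a b c n k (T k) (π k).length x.length t ht)
    change _ + (_ + (((FrontEnd.wordBits (m := m) (π k).reverse 1).length + 1) + _)) ≤ _
    omega
  · rw [← hans]
    exact congrArg (fun l => (List.head? l).map M.outputAlphabet) hk'

/-! ### From **FPE** to **para-E** -/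

section FPE

/-- Words over `{0, 1}` consist of units (`1`) of the parameter and of ticks (`0`). -/
def keepUnits : A ⊕ Fin 2 ⊕ Bool → Option (A ⊕ Unit ⊕ Bool)
  | .inl a => some (.inl a)
  | .inr (.inl i) => if i = 1 then some (.inr (.inl ())) else none
  | .inr (.inr b) => some (.inr (.inr b))

/-- Is the symbol the letter `i` of the word? -/
def isLetter (i : Fin 2) : A ⊕ Fin 2 ⊕ Bool → Bool
  | .inr (.inl j) => j = i
  | _ => false

theorem filterMap_keepUnits (x : List A) (n : ℕ) (y : List (Fin 2)) :
    (encodeWord (x, n, y)).filterMap keepUnits = encodeBi (x, n, y.count 1) := by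
  have h : y.filterMap (fun i => keepUnits (.inr (.inl i) : A ⊕ Fin 2 ⊕ Bool)) =
      (List.replicate (y.count 1) ()).map fun u => .inr (.inl u) := by
    induction y with
    | nil => rfl
    | cons i y ih =>
      by_cases hi : i = 1
      · subst hi; simpa [keepUnits, List.replicate_succ] using ih
      · simpa [keepUnits, hi] using ih
  rw [encodeBi, encodeWord, filterMap_inputWord (sym := keepUnits) (fun _ => rfl) (fun _ => rfl), h,
    ← inputWord_eq_append]

theorem countP_isLetter (i : Fin 2) (x : List A) (n : ℕ) (y : List (Fin 2)) :
    (encodeWord (x, n, y)).countP (isLetter i) = y.count i := by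
  simp [encodeWord, inputWord, isLetter, List.countP_map, List.countP_replicate, comp_def,
    List.count, beq_eq_decide]

/-- The time of the front end, for any word `y` of length `l`, and of the machine for **FPE**. -/
theorem fpe_time_le (a b c n l X f t : ℕ) (hf : f ≤ l)
    (ht : t ≤ f * 2 ^ (a * n + b) * (X + 1) ^ c) :
    2 * X + 2 * n + 5 * l + 6 + t ≤ 2 ^ ((a + 1) * n + (b + 3)) * (X + l + 1) ^ (c + 1) := by
  have hE : n + 1 ≤ 2 ^ n := Nat.lt_two_pow_self
  have hW : 1 ≤ 2 ^ (a * n + b) := Nat.one_le_two_pow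
  have hP : 1 ≤ (X + l + 1) ^ c := Nat.one_le_pow _ _ (by omega)
  have h₁ : (X + 1) ^ c ≤ (X + l + 1) ^ c := Nat.pow_le_pow_left (by omega) c
  have e : 2 ^ ((a + 1) * n + (b + 3)) = 8 * (2 ^ (a * n + b) * 2 ^ n) := by
    rw [← pow_add, show (8 : ℕ) = 2 ^ 3 by norm_num, ← pow_add]; congr 1; ring
  have h₂ : t ≤ l * 2 ^ (a * n + b) * (X + l + 1) ^ c :=
    ht.trans (Nat.mul_le_mul (Nat.mul_le_mul_right _ hf) h₁)
  rw [e, pow_succ]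
  generalize 2 ^ n = E at *
  generalize 2 ^ (a * n + b) = W at *
  generalize (X + l + 1) ^ c = R at *
  have h₃ : X + l + n + 1 ≤ E * (X + l + 1) := by nlinarith
  have h₄ : 1 ≤ W * R := Nat.mul_pos hW hP
  have h₅ : l ≤ E * (X + l + 1) := by omega
  calc _ ≤ 7 * (E * (X + l + 1)) + l * (W * R) := by nlinarith
    _ ≤ 7 * (E * (X + l + 1)) * (W * R) + (E * (X + l + 1)) * (W * R) :=
      Nat.add_le_add (Nat.le_mul_of_pos_right _ h₄) (Nat.mul_le_mul_right _ h₅)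
    _ = _ := by ring

end FPE

/-- The precomputation supplies `k` in unary and `T k` ticks, where `T k ≥ f k` is the running time
of a code. A machine for **E** verifies that a word has enough ticks by running that code on
the units of the word against the clock. If it has, then `f k` is at most the length of the word,
so that the machine for **FPE** can be run without a clock. -/
theorem InFPE.inParaE [Finite A] {P : Set (List A × ℕ × ℕ)} (h : InFPE P) : InParaE P := by
  have := Fintype.ofFinite A
  obtain ⟨f, hf, a, b, c, hP⟩ := h
  obtain ⟨M, hM⟩ := decidedInTime_iff.1 hP
  -- The code returns the empty word, but followed by so many ones that writing them down takes
  -- at least `f k` steps: the input has length `2 * k`, and each step adds at most two symbols.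
  have hL : Computable fun k => 2 * f k + 2 * k + 1 :=
    Computable.succ.comp (Primrec.nat_add.to_comp.comp (Primrec.nat_double.to_comp.comp hf)
      Primrec.nat_double.to_comp)
  have hg : Computable fun k => wordNum ([] : List (Fin 0)) (2 * f k + 2 * k + 1) :=
    Primrec.nat_sub.to_comp.comp (primrec_two_pow.to_comp.comp hL) (Computable.const 1)
  obtain ⟨Λ, _, main, prog, T, hpush, hT, hrun⟩ := exists_finite_machine hg
  have hbits : ∀ k, trList [wordNum ([] : List (Fin 0)) (2 * f k + 2 * k + 1)] =
      FrontEnd.wordBits ([] : List (Fin 0)) (2 * f k + 2 * k + 1) ++ [Γ'.cons] := fun k => by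
    simp [trList, trNat_wordNum _ (Nat.succ_pos _)]
  have hlen : ∀ k, 2 * f k + 2 * k + 2 ≤ 2 * k + 2 * T k := fun k => by
    have hlen := length_stk_le_of_stepsTo hpush K'.main (hrun k)
    simp only [K'.elim, hbits, length_unaryStack, List.length_append, List.length_singleton] at hlen
    simpa [FrontEnd.wordBits, Nat.succ_le_iff] using hlen
  let E : FrontEnd M.tm (A ⊕ Fin 2 ⊕ Bool) :=
    mkFrontEnd M Λ main prog keepUnits (isLetter 1) (isLetter 0) 0
      (fun _ => .inr (.inr false)) true
  refine ⟨2, fun k => List.replicate k 1 ++ List.replicate (T k) 0,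
    {i | T (i.2.2.count 1) ≤ i.2.2.count 0 ∧ (i.1, i.2.1, i.2.2.count 1) ∈ P}, ?_,
    ⟨a + 1, b + 3, c + 1, decidedInTime_iff.2 ⟨E.aux M, ?_⟩⟩, fun x n k => ?_⟩
  · exact Primrec.list_append.to_comp.comp (primrec_replicate 1).to_comp
      ((primrec_replicate 0).to_comp.comp hT)
  · rintro ⟨x, n, y⟩
    have hy : y.count 1 + y.count 0 = y.length := by
      induction y with
      | nil => rfl
      | cons i y ih => fin_cases i <;> simp <;> omega
    have h₁ : (encodeWord (x, n, y)).length = x.length + n + y.length + 2 := by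
      simp [encodeWord, length_inputWord]
    have hcode := hrun (y.count 1)
    rw [hbits] at hcode
    -- Either the code halts before the clock runs out, and `M` is run, or the word is rejected.
    by_cases hT : T (y.count 1) ≤ y.count 0
    · obtain ⟨t, ht, d, hd, hl, ans, hans, hiff⟩ := hM (x, n, y.count 1)
      have hkeep : (encodeWord (x, n, y)).filterMap E.keep ++
          (([] : List (Fin 0)).map fun d => E.dec d.castSucc).reverse =
          (encodeBi (x, n, y.count 1)).map M.inputAlphabet.symm := by
        rw [← filterMap_keepUnits x n y, List.map_filterMap]
        exact List.append_nil _
      rw [← hkeep] at hd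
      obtain ⟨d', hd', hl', hk'⟩ := E.exists_stepsTo (u := ([] : List (Fin E.m)))
        (countP_isLetter 1 x n y) hcode
        (fun _ => hT.trans (countP_isLetter 0 x n y).ge) hd hl
      refine ⟨_, ?_, d', (E.initList_aux M _).symm ▸ hd', hl', ans, ?_, ?_⟩
      · have h₂ : ((encodeWord (x, n, y)).filterMap E.keep).length =
            x.length + n + y.count 1 + 2 := by
          have := congrArg List.length hkeep
          simpa [encodeBi, length_inputWord] using this
        have h₃ := hlen (y.count 1)
        refine le_trans ?_ (fpe_time_le a b c n y.length x.length (f (y.count 1)) t (by omega) ht)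
        have h₄ : ∀ L, (FrontEnd.wordBits ([] : List (Fin E.m)) L).length = L := fun L => by
          simp [FrontEnd.wordBits]
        simp only [h₄]
        omega
      · rw [← hans]
        exact congrArg (fun l => (List.head? l).map M.outputAlphabet) hk'
      · rw [hiff]
        exact (and_iff_right hT).symm
    · obtain ⟨d, hd, hl, hk⟩ := E.exists_stepsTo_of_lt (countP_isLetter 1 x n y) hcode rfl
        ((countP_isLetter 0 x n y).trans_lt (not_le.1 hT))
      refine ⟨_, ?_, d, (E.initList_aux M _).symm ▸ hd, hl, false, ?_, ?_⟩
      · refine le_trans ?_ (fpe_time_le a b c n y.length x.length 0 0 (by omega) (by omega))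
        have h₂ : (encodeWord (x, n, y)).countP E.isTick = y.count 0 := countP_isLetter 0 x n y
        simp only [h₁, h₂]
        omega
      · exact (congrArg (Option.map M.outputAlphabet) hk).trans (by
          simp [E, mkFrontEnd])
      · simp [hT]
  · simp [List.count_append, List.count_replicate]

/-! ### The bound with a power of the fine-grained parameter -/

/-- `n ^ p` is bounded by a function of `p` times `2 ^ n`. -/
theorem max_pow_le (n p : ℕ) : max n 2 ^ p ≤ (p.factorial * 2 ^ (p + 1)) * 2 ^ n := by
  calc max n 2 ^ p ≤ (n + 1 + 1) ^ p := Nat.pow_le_pow_left (by omega) p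
    _ ≤ (n + 1 + 1).ascFactorial p := Nat.pow_succ_le_ascFactorial _ _
    _ = p.factorial * (n + 1 + p).choose p := Nat.ascFactorial_eq_factorial_mul_choose _ _
    _ ≤ p.factorial * 2 ^ (n + 1 + p) := Nat.mul_le_mul_left _ (Nat.choose_le_two_pow _ _)
    _ = _ := by rw [mul_assoc, ← pow_add]; congr 2; ring

theorem inPowTime_iff_inFPE {P : Set (List A × ℕ × ℕ)} : InPowTime P ↔ InFPE P := by
  constructor
  · rintro ⟨f, hf, a, b, c, h⟩
    refine ⟨fun k => (f k).factorial * 2 ^ (f k + 1), ?_, a + 1, b, c, h.mono fun i => ?_⟩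
    · exact Primrec.nat_mul.to_comp.comp (primrec_factorial.to_comp.comp hf)
        (primrec_two_pow.to_comp.comp (Computable.succ.comp hf))
    · refine Nat.mul_le_mul_right _ ((Nat.mul_le_mul_right _ (max_pow_le _ _)).trans_eq ?_)
      rw [mul_assoc, ← pow_add]
      congr 2
      ring
  · rintro ⟨f, hf, a, b, c, h⟩
    refine ⟨f, hf, a, b, c, h.mono fun i => Nat.mul_le_mul_right _ (Nat.mul_le_mul_right _ ?_)⟩
    exact Nat.lt_two_pow_self.le.trans (Nat.pow_le_pow_left (le_max_right _ _) _)

end BiParam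

theorem mainTheorem3 {A : Type} [Finite A] (P : Set (List A × ℕ × ℕ)) :
    (BiParam.InParaE P ↔ BiParam.InFPE P) ∧ (BiParam.InParaE P ↔ BiParam.InPowTime P) := by
  have h : BiParam.InParaE P ↔ BiParam.InFPE P :=
    ⟨BiParam.InParaE.inFPE, BiParam.InFPE.inParaE⟩
  exact ⟨h, h.trans BiParam.inPowTime_iff_inFPE.symm⟩
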